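/- Let $X$ and $U$ be Banach spaces over the same field ($\mathbb R$ or $\mathbb C$), let $A$ be the generator of a strongly continuous semigroup $(T(t))_{t\ge 0}$ on $X$, let $B_0\in\mathcal L(U,X)$, $F\in\mathcal L(X,U)$, $\tau>0$, and $\omega\in\mathbb R$. For $x^0\in X$, the solution of the sampled-data system $$\dot x(t)=Ax(t)+B_0u(t)\quad(t\ge 0),\qquad x(0)=x^0,\qquad u(k\tau+t)=Fx(k\tau)\quad(0\le t<\tau,\ k=0,1,2,\dots)$$ is the function $x:[0,\infty)\to X$ defined recursively by $x(0)=x^0$ and $$x(k\tau+t)=T(t)x(k\tau)+\int_0^t T(s)B_0Fx(k\tau)\,ds\qquad (0<t\le\tau,\ k=0,1,2,\dots).$$ The system is called exponentially stable with decay rate greater than $\omega$ if there are $M\ge 1$ and $\widetilde\omega>\omega$ such that $\|x(t)\|\le Me^{-\widetilde\omega t}\|x^0\|$ for all $x^0\in X$ and $t\ge 0$. Theorem. Suppose that this system is exponentially stable with decay rate greater than $\omega$, and let $t_0>0$. Then there is $q\in(0,1)$ such that for every linear operator $D:\operatorname{dom}(A)\to X$ that is bounded with respect to the graph norm $\|x\|_A=\|x\|+\|Ax\|$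 on $\operatorname{dom}(A)$ and satisfies $$\int_0^{t_0}\|DT(s)x\|\,ds\le q\|x\|\qquad\text{for all }x\in\operatorname{dom}(A),$$ the operator $A+D$ with domain $\operatorname{dom}(A)$ generates a strongly continuous semigroup on $X$, and the perturbed sampled-data system, in which $A$ is replaced by $A+D$ (and $T$ by the semigroup generated by $A+D$), is also exponentially stable with decay rate greater than $\omega$. -/

import Mathlib

open Set Filter Topology

/-- A strongly continuous semigroup `(T t)`, `t ≥ 0`, of bounded linear operators on `X`.
The values of `toFun` at negative arguments are irrelevant. -/
structure C0Semigroup (𝕜 : Type*) (X : Type*) [RCLike 𝕜] [NormedAddCommGroup X]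
    [NormedSpace 𝕜 X] where
  toFun : ℝ → X →L[𝕜] X
  map_zero' : toFun 0 = ContinuousLinearMap.id 𝕜 X
  map_add' : ∀ s t : ℝ, 0 ≤ s → 0 ≤ t → toFun (s + t) = (toFun s).comp (toFun t)
  strongly_continuous' : ∀ x : X, ContinuousOn (fun t : ℝ => toFun t x) (Ici 0)

namespace C0Semigroup

variable {𝕜 : Type*} {X : Type*} [RCLike 𝕜] [NormedAddCommGroup X] [NormedSpace 𝕜 X]

instance : CoeFun (C0Semigroup 𝕜 X) (fun _ => ℝ → X →L[𝕜] X) := ⟨C0Semigroup.toFun⟩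

variable [NormedSpace ℝ X]

/-- `y` is the right derivative at `0` of the orbit `t ↦ T t x`. -/
def HasOrbitDeriv (T : C0Semigroup 𝕜 X) (x y : X) : Prop :=
  Tendsto (fun h : ℝ => h⁻¹ • (T h x - x)) (𝓝[>] 0) (𝓝 y)

theorem HasOrbitDeriv.unique {T : C0Semigroup 𝕜 X} {x y z : X}
    (hy : T.HasOrbitDeriv x y) (hz : T.HasOrbitDeriv x z) : y = z :=
  tendsto_nhds_unique hy hz

theorem HasOrbitDeriv.add {T : C0Semigroup 𝕜 X} {x x' y y' : X}
    (h : T.HasOrbitDeriv x y) (h' : T.HasOrbitDeriv x' y') :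
    T.HasOrbitDeriv (x + x') (y + y') := by
  refine (Tendsto.add h h').congr fun r => ?_
  rw [← smul_add, map_add]
  congr 1
  abel

theorem HasOrbitDeriv.zero (T : C0Semigroup 𝕜 X) : T.HasOrbitDeriv 0 0 := by
  unfold HasOrbitDeriv
  simp

variable [IsScalarTower ℝ 𝕜 X]

theorem HasOrbitDeriv.smul {T : C0Semigroup 𝕜 X} {x y : X} (c : 𝕜)
    (h : T.HasOrbitDeriv x y) : T.HasOrbitDeriv (c • x) (c • y) := by
  have : SMulCommClass ℝ 𝕜 X := IsScalarTower.to_smulCommClass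
  refine (Tendsto.const_smul h c).congr fun r => ?_
  rw [map_smul, ← smul_sub, smul_comm]

/-- The infinitesimal generator: its domain is the set of those `x` for which
`lim_{h ↓ 0} h⁻¹ (T h x - x)` exists, and its value at `x` is this limit. -/
noncomputable def generator (T : C0Semigroup 𝕜 X) : X →ₗ.[𝕜] X where
  domain :=
    { carrier := {x | ∃ y, T.HasOrbitDeriv x y}
      add_mem' := fun ⟨_, hy⟩ ⟨_, hz⟩ => ⟨_, hy.add hz⟩
      zero_mem' := ⟨0, HasOrbitDeriv.zero T⟩
      smul_mem' := fun c _ ⟨_, hy⟩ => ⟨_, hy.smul c⟩ }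
  toFun :=
    { toFun := fun x => Classical.choose x.2
      map_add' := fun x x' =>
        (Classical.choose_spec (x + x').2).unique
          ((Classical.choose_spec x.2).add (Classical.choose_spec x'.2))
      map_smul' := fun c x =>
        (Classical.choose_spec (c • x).2).unique ((Classical.choose_spec x.2).smul c) }

theorem generator_spec (T : C0Semigroup 𝕜 X) (x : T.generator.domain) :
    T.HasOrbitDeriv x (T.generator x) :=
  Classical.choose_spec x.2

theorem map_mem_domain (T : C0Semigroup 𝕜 X) {s : ℝ} (hs : 0 ≤ s) {x : X}
    (hx : x ∈ T.generator.domain) : T s x ∈ T.generator.domain := by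
  obtain ⟨y, hy⟩ := hx
  refine ⟨T s y, ?_⟩
  refine (((T s).continuous.tendsto y).comp hy).congr' ?_
  filter_upwards [self_mem_nhdsWithin] with h hh
  have hh' : (0 : ℝ) ≤ h := le_of_lt hh
  have e : T h (T s x) = T s (T h x) := by
    have h1 := congrArg (fun f => f x) (T.map_add' h s hh' hs)
    have h2 := congrArg (fun f => f x) (T.map_add' s h hs hh')
    simp only [ContinuousLinearMap.comp_apply] at h1 h2
    rw [← h1, ← h2, add_comm]
  simp only [Function.comp_apply]
  rw [e, ← map_sub]
  exact map_real_smul (T s) (T s).continuous h⁻¹ (T h x - x)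

/-- The orbit `s ↦ T s x` of a point `x` of the domain of the generator, as a curve in that
domain, for `s ≥ 0` (it is extended by the constant `x` to `s < 0`). -/
def domainOrbit (T : C0Semigroup 𝕜 X) (x : T.generator.domain) (s : ℝ) :
    T.generator.domain :=
  ⟨T (max s 0) x, T.map_mem_domain (le_max_right s 0) x.2⟩

theorem domainOrbit_coe (T : C0Semigroup 𝕜 X) (x : T.generator.domain) {s : ℝ}
    (hs : 0 ≤ s) : (T.domainOrbit x s : X) = T s x := by
  simp [domainOrbit, max_eq_left hs]

end C0Semigroup

section Perturbation

variable {𝕜 : Type*} {X : Type*} [RCLike 𝕜] [NormedAddCommGroup X] [NormedSpace 𝕜 X]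

/-- The linear operator `D : dom A → X` is bounded from `dom A`, equipped with the graph norm
`‖x‖ + ‖A x‖`, to `X`. -/
def IsGraphBounded (A : X →ₗ.[𝕜] X) (D : A.domain →ₗ[𝕜] X) : Prop :=
  ∃ C : ℝ, ∀ x : A.domain, ‖D x‖ ≤ C * (‖(x : X)‖ + ‖A x‖)

/-- The operator `A + D` with domain `dom A`. -/
def perturbedOperator (A : X →ₗ.[𝕜] X) (D : A.domain →ₗ[𝕜] X) : X →ₗ.[𝕜] X where
  domain := A.domain
  toFun := A.toFun + D

end Perturbation

section SampledData

variable {𝕜 : Type*} {X : Type*} {U : Type*} [RCLike 𝕜]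
  [NormedAddCommGroup X] [NormedSpace 𝕜 X] [NormedSpace ℝ X]
  [NormedAddCommGroup U] [NormedSpace 𝕜 U]

/-- `x` (restricted to `[0, ∞)`) is the solution, with initial state `x₀`, of the sampled-data
system `x' = A x + B₀ u`, `u (k τ + t) = F x (k τ)` for `0 ≤ t < τ`, where `A` is the generator
of `T`. -/
structure IsSampledDataSolution (T : C0Semigroup 𝕜 X) (B₀ : U →L[𝕜] X) (F : X →L[𝕜] U)
    (τ : ℝ) (x₀ : X) (x : ℝ → X) : Prop where
  init : x 0 = x₀
  step : ∀ k : ℕ, ∀ t ∈ Ioc (0 : ℝ) τ,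
    x (k * τ + t) = T t (x (k * τ)) + ∫ s in (0 : ℝ)..t, T s (B₀ (F (x (k * τ))))

/-- Every initial state has a solution. -/
theorem exists_isSampledDataSolution (T : C0Semigroup 𝕜 X) (B₀ : U →L[𝕜] X) (F : X →L[𝕜] U)
    {τ : ℝ} (hτ : 0 < τ) (x₀ : X) : ∃ x, IsSampledDataSolution T B₀ F τ x₀ x := by
  let f : ℝ → X → X := fun t z => T t z + ∫ s in (0 : ℝ)..t, T s (B₀ (F z))
  let z : ℕ → X := fun k => Nat.rec x₀ (fun _ w => f τ w) k
  have f0 : ∀ w, f 0 w = w := by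
    intro w
    simp [f, T.map_zero']
  let x : ℝ → X := fun t => f (t - ⌊t / τ⌋₊ * τ) (z ⌊t / τ⌋₊)
  have hx : ∀ k : ℕ, x (k * τ) = z k := by
    intro k
    have : ⌊(k * τ) / τ⌋₊ = k := by
      rw [mul_div_assoc, div_self hτ.ne', mul_one, Nat.floor_natCast]
    simp only [x, this, sub_self, f0]
  have hx0 : x 0 = x₀ := by
    have h0 := hx 0
    rw [Nat.cast_zero, zero_mul] at h0
    exact h0
  refine ⟨x, ⟨hx0, ?_⟩⟩
  rintro k t ⟨ht0, ht⟩
  rw [hx k]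
  change x (k * τ + t) = f t (z k)
  rcases ht.lt_or_eq with h | h
  · have : ⌊(k * τ + t) / τ⌋₊ = k := by
      rw [Nat.floor_eq_iff (by positivity), le_div_iff₀ hτ, div_lt_iff₀ hτ]
      constructor <;> nlinarith
    simp only [x, this, add_sub_cancel_left]
  · have h1 : (k : ℝ) * τ + t = ((k + 1 : ℕ) : ℝ) * τ := by
      push_cast
      rw [h]
      ring
    rw [h1, hx, h]

/-- The values of a solution on `[0, ∞)` are determined by the initial state. -/
theorem IsSampledDataSolution.unique {T : C0Semigroup 𝕜 X} {B₀ : U →L[𝕜] X} {F : X →L[𝕜] U}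
    {τ : ℝ} (hτ : 0 < τ) {x₀ : X} {x y : ℝ → X} (hx : IsSampledDataSolution T B₀ F τ x₀ x)
    (hy : IsSampledDataSolution T B₀ F τ x₀ y) {t : ℝ} (ht : 0 ≤ t) : x t = y t := by
  have key : ∀ k : ℕ, x (k * τ) = y (k * τ) := by
    intro k
    induction k with
    | zero => simpa using hx.init.trans hy.init.symm
    | succ k ih =>
      have e : ((k + 1 : ℕ) : ℝ) * τ = k * τ + τ := by
        push_cast
        ring
      rw [e, hx.step k τ ⟨hτ, le_rfl⟩, hy.step k τ ⟨hτ, le_rfl⟩, ih]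
  have hk : (⌊t / τ⌋₊ : ℝ) * τ ≤ t := by
    rw [← le_div_iff₀ hτ]
    exact Nat.floor_le (by positivity)
  have hk' : t < ((⌊t / τ⌋₊ : ℝ) + 1) * τ := by
    rw [← div_lt_iff₀ hτ]
    exact Nat.lt_floor_add_one _
  rcases hk.lt_or_eq with h | h
  · have e : t = ⌊t / τ⌋₊ * τ + (t - ⌊t / τ⌋₊ * τ) := by ring
    have m : t - ⌊t / τ⌋₊ * τ ∈ Ioc (0 : ℝ) τ := ⟨by linarith, by nlinarith⟩
    rw [e, hx.step _ _ m, hy.step _ _ m, key]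
  · rw [← h, key]

/-- The sampled-data system given by `T`, `B₀`, `F` and the sampling period `τ` is exponentially
stable with decay rate greater than `ω`. -/
def IsExpStableWithRate (T : C0Semigroup 𝕜 X) (B₀ : U →L[𝕜] X) (F : X →L[𝕜] U)
    (τ ω : ℝ) : Prop :=
  ∃ M : ℝ, 1 ≤ M ∧ ∃ ω' : ℝ, ω < ω' ∧ ∀ (x₀ : X) (x : ℝ → X),
    IsSampledDataSolution T B₀ F τ x₀ x →
      ∀ t : ℝ, 0 ≤ t → ‖x t‖ ≤ M * Real.exp (-ω' * t) * ‖x₀‖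

end SampledData

/-! At the sampling times the solution is `x (k * τ) = P ^ k x₀`, where `P z = T τ z + ∫₀^τ T s B₀ F
z ds` is a bounded operator. Exponential stability with rate `ω'` therefore amounts to `‖P ^ k‖ ≤ M
r ^ k` with `r = exp (-ω' τ)`. A bound on powers survives small perturbations in operator norm: if
`M * ‖Q - P‖ ≤ ρ - r`, then `‖Q ^ k‖ ≤ M ρ ^ k` (`norm_pow_le_of_norm_sub_le`). It remains to
generate the perturbed semigroup `S` and to make `‖S t - T t‖` small, uniformly on `[0, τ]` and in
`D`.

Generation is Miyadera's theorem. After rescaling by `exp (-l t)`, with `l` so large that `T t₀`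
becomes a contraction by `1/2`, the integral condition extends from `[0, t₀]` to the half line with
constant `2q`. For `q ≤ 1/4` the Volterra equation `Φ t x = exp (-l t) T t x + ∫₀ᵗ Φ (t - s) (exp
(-l s) D T s x) ds` is a fixed point problem for a contraction, and `S t = exp (l t) Φ t` is a
semigroup whose generator extends `A + D`. Equality holds because `l + 1 - (A + D)` is surjective,
while `l + 1` exceeds the growth rate of `S` and so is not an eigenvalue of its generator.

Closeness comes from `S t x - T t x = ∫₀ᵗ S (t - s) D T s x ds`, which gives `‖S t - T t‖ ≤ const *
q` with a constant independent of `D` (`MiyaderaBound.norm_sub_le`). -/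

open scoped BoundedContinuousFunction

/-- A bootstrap for Volterra inequalities: the supremum satisfies `sup ≤ c + sup / 2`, and the a
priori bound, whose size is irrelevant, allows the last term to be absorbed. -/
theorem le_two_mul_of_forall_bound_improves {ι : Type*} {f : ι → ℝ} {c : ℝ}
    (hbdd : ∃ B, ∀ i, f i ≤ B)
    (himp : ∀ B, (∀ i, f i ≤ B) → ∀ i, f i ≤ c + B / 2) (i : ι) : f i ≤ 2 * c := by
  obtain ⟨B, hB⟩ := hbdd
  have hb : BddAbove (range f) := ⟨B, by rintro _ ⟨j, rfl⟩; exact hB j⟩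
  have : Nonempty ι := ⟨i⟩
  have h1 : iSup f ≤ c + iSup f / 2 := ciSup_le (himp _ fun j => le_ciSup hb j)
  have h2 := le_ciSup hb i
  linarith

theorem ContinuousLinearMap.opNorm_le_of_dense {𝕜 X Y : Type*} [RCLike 𝕜]
    [NormedAddCommGroup X] [NormedSpace 𝕜 X] [NormedAddCommGroup Y] [NormedSpace 𝕜 Y]
    (L : X →L[𝕜] Y) {s : Set X} (hs : Dense s) {c : ℝ} (hc : 0 ≤ c)
    (h : ∀ x ∈ s, ‖L x‖ ≤ c * ‖x‖) : ‖L‖ ≤ c :=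
  L.opNorm_le_bound hc <| hs.induction h <|
    isClosed_le L.continuous.norm (continuous_const.mul continuous_norm)

/-- The average of a jointly continuous function over a shrinking interval. -/
theorem tendsto_average_of_continuous {X : Type*} [NormedAddCommGroup X] [NormedSpace ℝ X]
    [CompleteSpace X] {k : ℝ → ℝ → X} (hk : Continuous (Function.uncurry k)) :
    Tendsto (fun h : ℝ => h⁻¹ • ∫ s in (0 : ℝ)..h, k h s) (𝓝[>] 0) (𝓝 (k 0 0)) := by
  rw [Metric.tendsto_nhdsWithin_nhds]
  intro ε hε
  obtain ⟨δ, hδ, hd⟩ := Metric.continuous_iff.1 hk (0, 0) (ε / 2) (by positivity)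
  refine ⟨δ, hδ, fun h hh hhd => ?_⟩
  have hpos : 0 < h := hh
  have hkh : Continuous (k h) := hk.comp (Continuous.prodMk_right h)
  have e : h⁻¹ • (∫ s in (0 : ℝ)..h, k h s) - k 0 0
      = h⁻¹ • ∫ s in (0 : ℝ)..h, (k h s - k 0 0) := by
    rw [intervalIntegral.integral_sub (hkh.intervalIntegrable _ _) (by simp),
      intervalIntegral.integral_const, smul_sub, sub_zero, smul_smul, inv_mul_cancel₀ hpos.ne',
      one_smul]
  rw [dist_eq_norm, e, norm_smul, norm_inv, Real.norm_of_nonneg hpos.le]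
  have hb : ‖∫ s in (0 : ℝ)..h, (k h s - k 0 0)‖ ≤ ε / 2 * |h - 0| := by
    refine intervalIntegral.norm_integral_le_of_norm_le_const fun s hs => ?_
    rw [uIoc_of_le hpos.le] at hs
    have := hd (h, s) (by
      rw [Real.dist_eq, sub_zero, abs_of_pos hpos] at hhd
      simp only [Prod.dist_eq, Real.dist_eq, sub_zero, abs_of_pos hpos, abs_of_pos hs.1]
      exact max_lt hhd (hs.2.trans_lt hhd))
    rw [dist_eq_norm] at this
    exact this.le
  rw [sub_zero, abs_of_pos hpos] at hb
  calc h⁻¹ * ‖∫ s in (0 : ℝ)..h, (k h s - k 0 0)‖ ≤ h⁻¹ * (ε / 2 * h) := by gcongr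
    _ = ε / 2 := by field_simp
    _ < ε := by linarith

/-! ### Strongly continuous semigroups: growth, orbits, density of the domain -/

namespace C0Semigroup

variable {𝕜 : Type*} {X : Type*} [RCLike 𝕜] [NormedAddCommGroup X] [NormedSpace 𝕜 X]

theorem add_apply (T : C0Semigroup 𝕜 X) {s t : ℝ} (hs : 0 ≤ s) (ht : 0 ≤ t) (x : X) :
    T (s + t) x = T s (T t x) := by
  rw [T.map_add' s t hs ht]; rfl

theorem zero_apply (T : C0Semigroup 𝕜 X) (x : X) : T 0 x = x := by
  rw [T.map_zero']; rfl

theorem continuous_orbit (T : C0Semigroup 𝕜 X) (x : X) :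
    Continuous fun t : ℝ => T (max t 0) x :=
  (T.strongly_continuous' x).comp_continuous (continuous_id.max continuous_const)
    fun t => le_max_right t 0

theorem exists_bound_on_Icc [CompleteSpace X] (T : C0Semigroup 𝕜 X) (b : ℝ) :
    ∃ C : ℝ, 1 ≤ C ∧ ∀ t ∈ Icc (0 : ℝ) b, ‖T t‖ ≤ C := by
  obtain ⟨C, hC⟩ := banach_steinhaus (g := fun t : Icc (0 : ℝ) b => T t) (fun x => by
    obtain ⟨C, hC⟩ := (isCompact_Icc (a := (0 : ℝ)) (b := b)).exists_bound_of_continuousOn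
      ((T.strongly_continuous' x).mono fun t ht => ht.1)
    exact ⟨C, fun t => hC t t.2⟩)
  exact ⟨max 1 C, le_max_left _ _, fun t ht => (hC ⟨t, ht⟩).trans (le_max_right _ _)⟩

/-- Strong continuity becomes joint continuity because the operators are uniformly bounded on
compact time intervals. -/
theorem tendsto_apply [CompleteSpace X] (T : C0Semigroup 𝕜 X) {ι : Type*} {l : Filter ι}
    {r : ι → ℝ} {r₀ : ℝ} {z : ι → X} {z₀ : X} (hr : Tendsto r l (𝓝 r₀)) (hr0 : 0 ≤ r₀)
    (hpos : ∀ᶠ i in l, 0 ≤ r i) (hz : Tendsto z l (𝓝 z₀)) :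
    Tendsto (fun i => T (r i) (z i)) l (𝓝 (T r₀ z₀)) := by
  obtain ⟨C, hC1, hC⟩ := T.exists_bound_on_Icc (r₀ + 1)
  have h1 : Tendsto (fun i => T (r i) z₀) l (𝓝 (T r₀ z₀)) :=
    (T.strongly_continuous' z₀ r₀ hr0).tendsto.comp
      (tendsto_nhdsWithin_iff.2 ⟨hr, hpos⟩)
  have h2 : Tendsto (fun i => T (r i) (z i - z₀)) l (𝓝 0) := by
    have h3 : Tendsto (fun i => C * ‖z i - z₀‖) l (𝓝 0) := by
      simpa using ((tendsto_sub_nhds_zero_iff.2 hz).norm).const_mul C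
    refine squeeze_zero_norm' ?_ h3
    filter_upwards [hpos, hr.eventually (eventually_le_nhds (lt_add_one r₀))] with i hi hi'
    exact (T (r i)).le_of_opNorm_le (hC _ ⟨hi, hi'⟩) _
  have h4 := h2.add h1
  rw [zero_add] at h4
  refine h4.congr fun i => ?_
  rw [map_sub, sub_add_cancel]

theorem continuous_apply [CompleteSpace X] (T : C0Semigroup 𝕜 X) {Y : Type*}
    [TopologicalSpace Y] {r : Y → ℝ} {z : Y → X} (hr : Continuous r) (hz : Continuous z) :
    Continuous fun y => T (max (r y) 0) (z y) :=
  continuous_iff_continuousAt.2 fun y =>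
    T.tendsto_apply ((hr.max continuous_const).tendsto y) (le_max_right _ _)
      (Eventually.of_forall fun _ => le_max_right _ _) (hz.tendsto y)

/-- Exponential growth with a rate for which the rescaled semigroup contracts by a factor two
over one time `t₀`. -/
theorem exists_growth_bound [CompleteSpace X] (T : C0Semigroup 𝕜 X) {t₀ : ℝ} (ht₀ : 0 < t₀) :
    ∃ μ : ℝ, 0 ≤ μ ∧ ∃ C : ℝ, 1 ≤ C ∧ Real.exp (-μ * t₀) * ‖T t₀‖ ≤ 1 / 2 ∧
      ∀ t, 0 ≤ t → Real.exp (-μ * t) * ‖T t‖ ≤ C := by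
  obtain ⟨C, hC1, hC⟩ := T.exists_bound_on_Icc t₀
  have hmu : ∃ μ : ℝ, 0 ≤ μ ∧ Real.exp (-μ * t₀) * C ≤ 1 / 2 := by
    -- The rate is chosen so that `exp (-μ * t₀) * C = 1 / 2`.
    refine ⟨Real.log (2 * C) / t₀, div_nonneg (Real.log_nonneg (by linarith)) ht₀.le, ?_⟩
    have : -(Real.log (2 * C) / t₀) * t₀ = -Real.log (2 * C) := by field_simp
    rw [this, Real.exp_neg, Real.exp_log (by linarith)]
    have : C ≠ 0 := by linarith
    field_simp
    norm_num
  obtain ⟨μ, hμ, hμC⟩ := hmu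
  have hhalf : Real.exp (-μ * t₀) * ‖T t₀‖ ≤ 1 / 2 :=
    le_trans (by gcongr; exact hC _ ⟨ht₀.le, le_rfl⟩) hμC
  refine ⟨μ, hμ, C, hC1, hhalf, ?_⟩
  have key : ∀ n : ℕ, ∀ t, 0 ≤ t → t ≤ n * t₀ → Real.exp (-μ * t) * ‖T t‖ ≤ C := by
    have small : ∀ t, 0 ≤ t → t ≤ t₀ → Real.exp (-μ * t) * ‖T t‖ ≤ C := fun t h0 h1 => by
      have h2 : Real.exp (-μ * t) ≤ 1 := Real.exp_le_one_iff.2 (by nlinarith)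
      calc Real.exp (-μ * t) * ‖T t‖ ≤ 1 * C := by gcongr; exact hC _ ⟨h0, h1⟩
        _ = C := one_mul C
    intro n
    induction n with
    | zero => exact fun t h0 h1 => small t h0 (by simp at h1; linarith)
    | succ n ih =>
      intro t h0 h1
      rcases le_total t t₀ with h | h
      · exact small t h0 h
      have h2 := ih (t - t₀) (by linarith) (by push_cast at h1; linarith)
      have e : T t = (T (t - t₀)).comp (T t₀) := by
        rw [← T.map_add' _ _ (by linarith) ht₀.le, sub_add_cancel]
      have e2 : Real.exp (-μ * t) = Real.exp (-μ * (t - t₀)) * Real.exp (-μ * t₀) := by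
        rw [← Real.exp_add]; ring_nf
      calc Real.exp (-μ * t) * ‖T t‖
          ≤ Real.exp (-μ * (t - t₀)) * Real.exp (-μ * t₀) * (‖T (t - t₀)‖ * ‖T t₀‖) := by
            rw [e2, e]; gcongr; exact ContinuousLinearMap.opNorm_comp_le _ _
        _ = (Real.exp (-μ * (t - t₀)) * ‖T (t - t₀)‖) * (Real.exp (-μ * t₀) * ‖T t₀‖) := by ring
        _ ≤ C * (1 / 2) := by gcongr
        _ ≤ C := by linarith
  intro t ht
  obtain ⟨n, hn⟩ := exists_nat_ge (t / t₀)
  exact key n t ht ((div_le_iff₀ ht₀).1 hn)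

variable [NormedSpace ℝ X]

/-- The rescaled orbit `t ↦ e^{-λ t} T t x`, frozen at negative times. -/
noncomputable def rescaledOrbit (T : C0Semigroup 𝕜 X) (l : ℝ) (x : X) (s : ℝ) : X :=
  Real.exp (-l * s) • T (max s 0) x

theorem rescaledOrbit_of_nonneg (T : C0Semigroup 𝕜 X) (l : ℝ) (x : X) {s : ℝ} (hs : 0 ≤ s) :
    T.rescaledOrbit l x s = Real.exp (-l * s) • T s x := by
  rw [rescaledOrbit, max_eq_left hs]

theorem continuous_rescaledOrbit (T : C0Semigroup 𝕜 X) (l : ℝ) (x : X) :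
    Continuous (T.rescaledOrbit l x) :=
  (by fun_prop : Continuous fun s : ℝ => Real.exp (-l * s)).smul (T.continuous_orbit x)

/-- Right derivatives follow from the semigroup law alone, and they suffice: a continuous function
is recovered by integrating its integrable right derivative. -/
theorem HasOrbitDeriv.hasDerivWithinAt {T : C0Semigroup 𝕜 X} {x y : X}
    (h : T.HasOrbitDeriv x y) {t : ℝ} (ht : 0 ≤ t) :
    HasDerivWithinAt (fun s => T s x) (T t y) (Ioi t) t := by
  rw [hasDerivWithinAt_iff_tendsto_slope' (by simp)]
  have h1 : Tendsto (fun s : ℝ => s - t) (𝓝[>] t) (𝓝[>] 0) := by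
    refine tendsto_nhdsWithin_iff.2 ⟨?_, ?_⟩
    · have : Tendsto (fun s : ℝ => s - t) (𝓝 t) (𝓝 (t - t)) :=
        (continuous_id.sub continuous_const).tendsto t
      rw [sub_self] at this
      exact this.mono_left nhdsWithin_le_nhds
    · filter_upwards [self_mem_nhdsWithin] with s hs
      exact mem_Ioi.2 (sub_pos.2 (mem_Ioi.1 hs))
  have h2 := ((T t).continuous.tendsto y).comp (Tendsto.comp h h1)
  refine h2.congr' ?_
  filter_upwards [self_mem_nhdsWithin] with s hs
  have hs' : t < s := hs
  have e : T s x = T t (T (s - t) x) := by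
    rw [← T.add_apply ht (by linarith), add_sub_cancel]
  simp only [Function.comp_apply, slope_def_module]
  rw [map_real_smul (T t) (T t).continuous, map_sub, ← e]

theorem HasOrbitDeriv.hasDerivWithinAt_rescaledOrbit {T : C0Semigroup 𝕜 X} {x y : X}
    (h : T.HasOrbitDeriv x y) (l : ℝ) {t : ℝ} (ht : 0 ≤ t) :
    HasDerivWithinAt (T.rescaledOrbit l x)
      (Real.exp (-l * t) • T t y + (-l * Real.exp (-l * t)) • T t x) (Ioi t) t := by
  have b : HasDerivAt (fun r : ℝ => Real.exp (-l * r)) (-l * Real.exp (-l * t)) t := by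
    have := ((hasDerivAt_id t).const_mul (-l)).exp
    simpa [mul_comm] using this
  refine (b.hasDerivWithinAt.smul (h.hasDerivWithinAt ht)).congr_of_eventuallyEq ?_ ?_
  · filter_upwards [self_mem_nhdsWithin] with r hr
    exact T.rescaledOrbit_of_nonneg l x (ht.trans (le_of_lt hr))
  · exact T.rescaledOrbit_of_nonneg l x ht

theorem HasOrbitDeriv.of_hasDerivWithinAt {T : C0Semigroup 𝕜 X} {x y : X}
    (h : HasDerivWithinAt (fun s => T s x) y (Ioi 0) 0) : T.HasOrbitDeriv x y := by
  rw [hasDerivWithinAt_iff_tendsto_slope' (by simp)] at h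
  refine h.congr fun s => ?_
  rw [slope_def_module, sub_zero, T.zero_apply]

/-- The truncated Laplace transform of an orbit lies in the domain of the generator. -/
theorem hasOrbitDeriv_integral_rescaledOrbit [CompleteSpace X] (T : C0Semigroup 𝕜 X) (l : ℝ)
    (x : X) {t : ℝ} (ht : 0 ≤ t) :
    T.HasOrbitDeriv (∫ s in (0 : ℝ)..t, T.rescaledOrbit l x s)
      (Real.exp (-l * t) • T t x - x + l • ∫ s in (0 : ℝ)..t, T.rescaledOrbit l x s) := by
  set g := T.rescaledOrbit l x with hg
  have hgc : Continuous g := T.continuous_rescaledOrbit l x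
  set G : ℝ → X := fun u => ∫ s in (0 : ℝ)..u, g s with hG
  have hGd : ∀ u, HasDerivAt G (g u) u := fun u =>
    (hgc.integral_hasStrictDerivAt 0 u).hasDerivAt
  have h1 : HasDerivAt (fun h : ℝ => G (t + h)) (g t) 0 := by
    have := HasDerivAt.comp_const_add t (0 : ℝ) (f := G) (f' := g t) (by simpa using hGd t)
    exact this
  have h2 : HasDerivAt (fun h : ℝ => Real.exp (l * h)) l 0 := by
    have := ((hasDerivAt_id (0 : ℝ)).const_mul l).exp
    simpa using this
  have h3 := h2.smul (h1.sub (hGd 0))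
  have g0 : g 0 = x := by
    rw [hg, T.rescaledOrbit_of_nonneg l x le_rfl, T.zero_apply]; simp
  have gt : g t = Real.exp (-l * t) • T t x := T.rescaledOrbit_of_nonneg l x ht
  have G0 : G 0 = 0 := by simp [hG]
  refine HasOrbitDeriv.of_hasDerivWithinAt ?_
  -- With `G` the primitive of the rescaled orbit, a shift of the integration variable gives `T h (G
  -- t) = exp (l * h) • (G (t + h) - G h)`, which is differentiable in `h` for every `x`.
  have h4 : HasDerivWithinAt (fun h : ℝ => Real.exp (l * h) • (G (t + h) - G h))
      (g t - x + l • G t) (Ioi 0) 0 := by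
    refine HasDerivAt.hasDerivWithinAt ?_
    refine h3.congr_deriv ?_
    simp [g0, G0]
  rw [← gt]
  refine h4.congr_of_eventuallyEq ?_ ?_
  · filter_upwards [self_mem_nhdsWithin] with h hh
    have hh0 : 0 ≤ h := le_of_lt hh
    have e1 : T h (G t) = ∫ s in (0 : ℝ)..t, T h (g s) :=
      ((T h).intervalIntegral_comp_comm (hgc.intervalIntegrable 0 t)).symm
    have e2 : ∫ s in (0 : ℝ)..t, T h (g s)
        = ∫ s in (0 : ℝ)..t, Real.exp (l * h) • g (s + h) := by
      refine intervalIntegral.integral_congr fun s hs => ?_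
      rw [uIcc_of_le ht] at hs
      have hs0 := hs.1
      simp only [hg]
      rw [T.rescaledOrbit_of_nonneg l x hs0, T.rescaledOrbit_of_nonneg l x (by linarith),
        map_real_smul (T h) (T h).continuous, ← T.add_apply hh0 hs0, smul_smul, ← Real.exp_add,
        add_comm h s]
      ring_nf
    have e3 : ∫ s in (0 : ℝ)..t, g (s + h) = G (t + h) - G h := by
      rw [intervalIntegral.integral_comp_add_right, zero_add, hG]
      exact (intervalIntegral.integral_interval_sub_left (hgc.intervalIntegrable _ _)
        (hgc.intervalIntegrable _ _)).symm
    change T h (G t) = _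
    rw [e1, e2, intervalIntegral.integral_smul, e3]
  · change T 0 (G t) = _
    rw [T.zero_apply]; simp [G0]

variable [IsScalarTower ℝ 𝕜 X]

theorem HasOrbitDeriv.mem_domain {T : C0Semigroup 𝕜 X} {x y : X} (h : T.HasOrbitDeriv x y) :
    x ∈ T.generator.domain :=
  ⟨y, h⟩

theorem HasOrbitDeriv.generator_eq {T : C0Semigroup 𝕜 X} {x : T.generator.domain} {y : X}
    (h : T.HasOrbitDeriv x y) : T.generator x = y :=
  (T.generator_spec x).unique h

/-- The averages `h⁻¹ ∫₀ʰ T s x ds` lie in the domain and tend to `x`. -/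
theorem dense_domain [CompleteSpace X] (T : C0Semigroup 𝕜 X) :
    Dense (T.generator.domain : Set X) := by
  intro x
  have h := tendsto_average_of_continuous (k := fun _ s => T.rescaledOrbit 0 x s)
    ((T.continuous_rescaledOrbit 0 x).comp continuous_snd)
  rw [T.rescaledOrbit_of_nonneg 0 x le_rfl, T.zero_apply] at h
  simp only [neg_zero, zero_mul, Real.exp_zero, one_smul] at h
  refine mem_closure_of_tendsto h ?_
  filter_upwards [self_mem_nhdsWithin] with t ht
  have := (T.hasOrbitDeriv_integral_rescaledOrbit 0 x (le_of_lt ht)).mem_domain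
  have h2 := T.generator.domain.smul_mem ((t⁻¹ : ℝ) : 𝕜) this
  have e : ∀ z : X, ((t⁻¹ : ℝ) : 𝕜) • z = t⁻¹ • z := fun z => by
    rw [← RCLike.real_smul_eq_coe_smul (K := 𝕜)]
  rw [e] at h2
  exact h2

theorem generator_map_apply (T : C0Semigroup 𝕜 X) {s : ℝ} (hs : 0 ≤ s)
    (x : T.generator.domain) :
    T.generator ⟨T s x, T.map_mem_domain hs x.2⟩ = T s (T.generator x) := by
  refine HasOrbitDeriv.generator_eq ?_
  refine (((T s).continuous.tendsto _).comp (T.generator_spec x)).congr' ?_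
  filter_upwards [self_mem_nhdsWithin] with h hh
  have hh' : (0 : ℝ) ≤ h := le_of_lt hh
  simp only [Function.comp_apply]
  rw [map_real_smul (T s) (T s).continuous, map_sub, ← T.add_apply hs hh', add_comm,
    T.add_apply hh' hs]

end C0Semigroup

/-! ### Graph-bounded perturbations along orbits and the Miyadera condition -/

theorem IsGraphBounded.tendsto {𝕜 X : Type*} [RCLike 𝕜] [NormedAddCommGroup X]
    [NormedSpace 𝕜 X] {A : X →ₗ.[𝕜] X} {D : A.domain →ₗ[𝕜] X} (hD : IsGraphBounded A D)
    {ι : Type*} {l : Filter ι} {z : ι → A.domain} {z₀ : A.domain}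
    (h1 : Tendsto (fun i => (z i : X)) l (𝓝 z₀)) (h2 : Tendsto (fun i => A (z i)) l (𝓝 (A z₀))) :
    Tendsto (fun i => D (z i)) l (𝓝 (D z₀)) := by
  obtain ⟨C, hC⟩ := hD
  rw [← tendsto_sub_nhds_zero_iff]
  have h3 : Tendsto (fun i => C * (‖(z i : X) - z₀‖ + ‖A (z i) - A z₀‖)) l (𝓝 0) := by
    simpa using (((tendsto_sub_nhds_zero_iff.2 h1).norm).add
      ((tendsto_sub_nhds_zero_iff.2 h2).norm)).const_mul C
  refine squeeze_zero_norm (fun i => ?_) h3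
  have := hC (z i - z₀)
  rwa [map_sub, A.map_sub] at this

/-- Difference quotients that converge together with their images under `A` converge in the graph
norm, so `D` may be applied to the limit. -/
theorem IsGraphBounded.hasDerivWithinAt {𝕜 X : Type*} [RCLike 𝕜] [NormedAddCommGroup X]
    [NormedSpace 𝕜 X] [NormedSpace ℝ X] [IsScalarTower ℝ 𝕜 X] {A : X →ₗ.[𝕜] X}
    {D : A.domain →ₗ[𝕜] X} (hD : IsGraphBounded A D) {u : ℝ → A.domain} {v : A.domain} {s : ℝ}
    (h1 : HasDerivWithinAt (fun r => (u r : X)) v (Ioi s) s)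
    (h2 : HasDerivWithinAt (fun r => A (u r)) (A v) (Ioi s) s) :
    HasDerivWithinAt (fun r => D (u r)) (D v) (Ioi s) s := by
  rw [hasDerivWithinAt_iff_tendsto_slope' (by simp)] at h1 h2 ⊢
  have key := hD.tendsto (z := fun r => (((r - s)⁻¹ : ℝ) : 𝕜) • (u r - u s)) (z₀ := v)
    (l := 𝓝[>] s) (h1.congr fun r => by
      rw [slope_def_module, RCLike.real_smul_eq_coe_smul (K := 𝕜)]; rfl)
    (h2.congr fun r => by
      rw [slope_def_module, RCLike.real_smul_eq_coe_smul (K := 𝕜), A.map_smul, A.map_sub])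
  refine key.congr fun r => ?_
  rw [slope_def_module, RCLike.real_smul_eq_coe_smul (K := 𝕜), map_smul, map_sub]

namespace C0Semigroup

variable {𝕜 : Type*} {X : Type*} [RCLike 𝕜] [NormedAddCommGroup X] [NormedSpace 𝕜 X]
  [NormedSpace ℝ X] [IsScalarTower ℝ 𝕜 X]

/-- Orbits in the domain are continuous in the graph norm, since `A T s x = T s A x`. -/
theorem continuous_perturbation_domainOrbit (T : C0Semigroup 𝕜 X)
    {D : T.generator.domain →ₗ[𝕜] X} (hD : IsGraphBounded T.generator D)
    (x : T.generator.domain) : Continuous fun s => D (T.domainOrbit x s) := by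
  refine continuous_iff_continuousAt.2 fun s => hD.tendsto ?_ ?_
  · exact (T.continuous_orbit x).tendsto s
  · have e : ∀ r, T.generator (T.domainOrbit x r) = T (max r 0) (T.generator x) :=
      fun r => T.generator_map_apply (le_max_right r 0) x
    simp only [e]
    exact (T.continuous_orbit _).tendsto s

/-- The rescaled curve `s ↦ e^{-λ s} D T s x`. -/
noncomputable def rescaledForcing (T : C0Semigroup 𝕜 X) (D : T.generator.domain →ₗ[𝕜] X)
    (l : ℝ) (x : T.generator.domain) (s : ℝ) : X :=
  Real.exp (-l * s) • D (T.domainOrbit x s)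

theorem continuous_rescaledForcing (T : C0Semigroup 𝕜 X) {D : T.generator.domain →ₗ[𝕜] X}
    (hD : IsGraphBounded T.generator D) (l : ℝ) (x : T.generator.domain) :
    Continuous (T.rescaledForcing D l x) :=
  (by fun_prop : Continuous fun s : ℝ => Real.exp (-l * s)).smul
    (T.continuous_perturbation_domainOrbit hD x)

theorem domainOrbit_add (T : C0Semigroup 𝕜 X) (x y : T.generator.domain) (s : ℝ) :
    T.domainOrbit (x + y) s = T.domainOrbit x s + T.domainOrbit y s :=
  Subtype.ext (map_add (T (max s 0)) (x : X) y)

theorem domainOrbit_smul (T : C0Semigroup 𝕜 X) (c : 𝕜) (x : T.generator.domain) (s : ℝ) :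
    T.domainOrbit (c • x) s = c • T.domainOrbit x s :=
  Subtype.ext (map_smul (T (max s 0)) c (x : X))

theorem rescaledForcing_add (T : C0Semigroup 𝕜 X) (D : T.generator.domain →ₗ[𝕜] X)
    (l : ℝ) (x y : T.generator.domain) (s : ℝ) :
    T.rescaledForcing D l (x + y) s = T.rescaledForcing D l x s + T.rescaledForcing D l y s := by
  simp only [rescaledForcing, domainOrbit_add, map_add, smul_add]

theorem rescaledForcing_smul (T : C0Semigroup 𝕜 X) (D : T.generator.domain →ₗ[𝕜] X)
    (l : ℝ) (c : 𝕜) (x : T.generator.domain) (s : ℝ) :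
    T.rescaledForcing D l (c • x) s = c • T.rescaledForcing D l x s := by
  have : SMulCommClass ℝ 𝕜 X := IsScalarTower.to_smulCommClass
  simp only [rescaledForcing, domainOrbit_smul, map_smul]
  rw [smul_comm]

theorem domainOrbit_add_time (T : C0Semigroup 𝕜 X) (x : T.generator.domain) {s a : ℝ}
    (hs : 0 ≤ s) (ha : 0 ≤ a) :
    T.domainOrbit x (s + a) = T.domainOrbit (T.domainOrbit x a) s := by
  refine Subtype.ext ?_
  rw [T.domainOrbit_coe _ hs, T.domainOrbit_coe _ ha, T.domainOrbit_coe _ (by positivity),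
    T.add_apply hs ha]

theorem rescaledForcing_add_time (T : C0Semigroup 𝕜 X) (D : T.generator.domain →ₗ[𝕜] X)
    (l : ℝ) (x : T.generator.domain) {s a : ℝ} (hs : 0 ≤ s) (ha : 0 ≤ a) :
    T.rescaledForcing D l x (s + a) =
      Real.exp (-l * a) • T.rescaledForcing D l (T.domainOrbit x a) s := by
  rw [rescaledForcing, rescaledForcing, T.domainOrbit_add_time x hs ha, smul_smul,
    ← Real.exp_add]
  ring_nf

theorem norm_rescaledForcing_le (T : C0Semigroup 𝕜 X) (D : T.generator.domain →ₗ[𝕜] X)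
    {l : ℝ} (hl : 0 ≤ l) (x : T.generator.domain) {s : ℝ} (hs : 0 ≤ s) :
    ‖T.rescaledForcing D l x s‖ ≤ ‖D (T.domainOrbit x s)‖ := by
  rw [rescaledForcing, norm_smul, Real.norm_of_nonneg (Real.exp_pos _).le]
  exact mul_le_of_le_one_left (norm_nonneg _) (Real.exp_le_one_iff.2 (by nlinarith))

/-- The Miyadera smallness condition on `[0, t₀]`. -/
def MiyaderaBound (T : C0Semigroup 𝕜 X) (D : T.generator.domain →ₗ[𝕜] X) (t₀ q : ℝ) : Prop :=
  ∀ x : T.generator.domain, (∫ s in (0 : ℝ)..t₀, ‖D (T.domainOrbit x s)‖) ≤ q * ‖(x : X)‖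

theorem MiyaderaBound.integral_norm_rescaledForcing_le_of_le {T : C0Semigroup 𝕜 X}
    {D : T.generator.domain →ₗ[𝕜] X} {t₀ q : ℝ} (h : T.MiyaderaBound D t₀ q)
    (hD : IsGraphBounded T.generator D) {l : ℝ} (hl : 0 ≤ l) (x : T.generator.domain) {t : ℝ}
    (ht : 0 ≤ t) (htt : t ≤ t₀) :
    (∫ s in (0 : ℝ)..t, ‖T.rescaledForcing D l x s‖) ≤ q * ‖(x : X)‖ := by
  have hc := (T.continuous_perturbation_domainOrbit hD x).norm
  calc (∫ s in (0 : ℝ)..t, ‖T.rescaledForcing D l x s‖)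
      ≤ ∫ s in (0 : ℝ)..t, ‖D (T.domainOrbit x s)‖ :=
        intervalIntegral.integral_mono_on ht
          ((T.continuous_rescaledForcing hD l x).norm.intervalIntegrable _ _)
          (hc.intervalIntegrable _ _) fun s hs => T.norm_rescaledForcing_le D hl x hs.1
    _ ≤ ∫ s in (0 : ℝ)..t₀, ‖D (T.domainOrbit x s)‖ :=
        intervalIntegral.integral_mono_interval le_rfl ht htt
          (Eventually.of_forall fun s => norm_nonneg _) (hc.intervalIntegrable _ _)
    _ ≤ q * ‖(x : X)‖ := h x

/-- The intervals of length `t₀` contribute a geometric series of ratio `1/2`, because the rescaled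
semigroup contracts by that factor over one interval. In the induction, `q + (1/2) * 2q = 2q`. -/
theorem MiyaderaBound.integral_norm_rescaledForcing_le {T : C0Semigroup 𝕜 X}
    {D : T.generator.domain →ₗ[𝕜] X} {t₀ q : ℝ} (h : T.MiyaderaBound D t₀ q)
    (hD : IsGraphBounded T.generator D) (hq : 0 ≤ q) (ht₀ : 0 < t₀) {l : ℝ} (hl : 0 ≤ l)
    (hhalf : Real.exp (-l * t₀) * ‖T t₀‖ ≤ 1 / 2) (x : T.generator.domain) {t : ℝ}
    (ht : 0 ≤ t) : (∫ s in (0 : ℝ)..t, ‖T.rescaledForcing D l x s‖) ≤ 2 * q * ‖(x : X)‖ := by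
  have small : ∀ (x : T.generator.domain) t, 0 ≤ t → t ≤ t₀ →
      (∫ s in (0 : ℝ)..t, ‖T.rescaledForcing D l x s‖) ≤ 2 * q * ‖(x : X)‖ :=
    fun x t h0 h1 => (h.integral_norm_rescaledForcing_le_of_le hD hl x h0 h1).trans
      (by have := mul_nonneg hq (norm_nonneg (x : X)); linarith)
  have key : ∀ n : ℕ, ∀ (x : T.generator.domain) t, 0 ≤ t → t ≤ n * t₀ →
      (∫ s in (0 : ℝ)..t, ‖T.rescaledForcing D l x s‖) ≤ 2 * q * ‖(x : X)‖ := by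
    intro n
    induction n with
    | zero => exact fun x t h0 h1 => small x t h0 (by simp at h1; linarith)
    | succ n ih =>
      intro x t h0 h1
      rcases le_total t t₀ with hle | hle
      · exact small x t h0 hle
      have hc := (T.continuous_rescaledForcing hD l x).norm
      rw [← intervalIntegral.integral_add_adjacent_intervals (hc.intervalIntegrable 0 t₀)
        (hc.intervalIntegrable t₀ t)]
      have e1 : (∫ s in t₀..t, ‖T.rescaledForcing D l x s‖)
          = ∫ s in (0 : ℝ)..(t - t₀), ‖T.rescaledForcing D l x (s + t₀)‖ := by
        rw [intervalIntegral.integral_comp_add_right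
          (fun s => ‖T.rescaledForcing D l x s‖)]
        simp
      have e2 : (∫ s in (0 : ℝ)..(t - t₀), ‖T.rescaledForcing D l x (s + t₀)‖)
          = Real.exp (-l * t₀) * ∫ s in (0 : ℝ)..(t - t₀),
            ‖T.rescaledForcing D l (T.domainOrbit x t₀) s‖ := by
        rw [← intervalIntegral.integral_const_mul]
        refine intervalIntegral.integral_congr fun s hs => ?_
        rw [uIcc_of_le (by linarith)] at hs
        rw [T.rescaledForcing_add_time D l x hs.1 ht₀.le, norm_smul,
          Real.norm_of_nonneg (Real.exp_pos _).le]
      have h2 := ih (T.domainOrbit x t₀) (t - t₀) (by linarith) (by push_cast at h1; linarith)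
      have h3 : ‖(T.domainOrbit x t₀ : X)‖ ≤ ‖T t₀‖ * ‖(x : X)‖ := by
        rw [T.domainOrbit_coe x ht₀.le]; exact (T t₀).le_opNorm _
      have h4 := h.integral_norm_rescaledForcing_le_of_le hD hl x ht₀.le le_rfl
      rw [e1, e2]
      calc _ ≤ q * ‖(x : X)‖
            + Real.exp (-l * t₀) * (2 * q * (‖T t₀‖ * ‖(x : X)‖)) := by
            gcongr
            exact h2.trans (by gcongr)
        _ = q * ‖(x : X)‖ + (Real.exp (-l * t₀) * ‖T t₀‖) * (2 * q * ‖(x : X)‖) := by ring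
        _ ≤ q * ‖(x : X)‖ + (1 / 2) * (2 * q * ‖(x : X)‖) := by gcongr
        _ = 2 * q * ‖(x : X)‖ := by ring
  obtain ⟨n, hn⟩ := exists_nat_ge (t / t₀)
  exact key n x t ht ((div_le_iff₀ ht₀).1 hn)

/-! ### The truncated Laplace transform and surjectivity of the resolvent equation -/

/-- The truncated Laplace transform `x ↦ ∫₀ᵗ e^{-λ s} T s x ds`, for `t ≥ 0`, as a map into the
domain of the generator. -/
noncomputable def truncatedLaplace [CompleteSpace X] (T : C0Semigroup 𝕜 X) (l t : ℝ) :
    X →ₗ[𝕜] T.generator.domain where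
  toFun x := ⟨∫ s in (0 : ℝ)..(max t 0), T.rescaledOrbit l x s,
    (T.hasOrbitDeriv_integral_rescaledOrbit l x (le_max_right t 0)).mem_domain⟩
  map_add' x y := by
    refine Subtype.ext ?_
    simp only [Submodule.coe_add]
    rw [← intervalIntegral.integral_add
      ((T.continuous_rescaledOrbit l x).intervalIntegrable _ _)
      ((T.continuous_rescaledOrbit l y).intervalIntegrable _ _)]
    simp only [rescaledOrbit, map_add, smul_add]
  map_smul' c x := by
    have : SMulCommClass ℝ 𝕜 X := IsScalarTower.to_smulCommClass
    refine Subtype.ext ?_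
    simp only [RingHom.id_apply, Submodule.coe_smul]
    rw [← intervalIntegral.integral_smul]
    simp only [rescaledOrbit, map_smul]
    simp_rw [smul_comm c]

section truncatedLaplace

variable [CompleteSpace X] (T : C0Semigroup 𝕜 X)

theorem truncatedLaplace_coe (l t : ℝ) (x : X) :
    (T.truncatedLaplace l t x : X) = ∫ s in (0 : ℝ)..(max t 0), T.rescaledOrbit l x s :=
  rfl

theorem generator_truncatedLaplace (l t : ℝ) (x : X) :
    T.generator (T.truncatedLaplace l t x) =
      T.rescaledOrbit l x (max t 0) - x + l • (T.truncatedLaplace l t x : X) := by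
  have h := T.hasOrbitDeriv_integral_rescaledOrbit l x (le_max_right t 0)
  rw [← truncatedLaplace_coe, ← T.rescaledOrbit_of_nonneg l x (le_max_right t 0)] at h
  exact h.generator_eq

theorem exists_norm_truncatedLaplace_le {l : ℝ} (hl : 0 ≤ l) (t : ℝ) :
    ∃ c, ∀ x, ‖(T.truncatedLaplace l t x : X)‖ ≤ c * ‖x‖ := by
  obtain ⟨C, hC1, hC⟩ := T.exists_bound_on_Icc (max t 0)
  refine ⟨C * |max t 0 - 0|, fun x => ?_⟩
  rw [truncatedLaplace_coe]
  refine (intervalIntegral.norm_integral_le_of_norm_le_const (C := C * ‖x‖)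
    fun s hs => ?_).trans_eq (by ring)
  rw [uIoc_of_le (le_max_right t 0)] at hs
  rw [T.rescaledOrbit_of_nonneg l x hs.1.le, norm_smul, Real.norm_of_nonneg (Real.exp_pos _).le]
  refine (mul_le_of_le_one_left (norm_nonneg _) (Real.exp_le_one_iff.2 (by nlinarith [hs.1]))).trans
    ?_
  exact (T s).le_of_opNorm_le (hC s ⟨hs.1.le, hs.2⟩) x

/-- `D` passes through the integral although it is not continuous on `X`: for `x` in the domain, the
truncated transform is right differentiable in the graph norm, so both sides have the same right
derivative in `t` and vanish at `0`. -/
theorem perturbation_truncatedLaplace {D : T.generator.domain →ₗ[𝕜] X}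
    (hD : IsGraphBounded T.generator D) (l : ℝ) (x : T.generator.domain) {t : ℝ} (ht : 0 ≤ t) :
    D (T.truncatedLaplace l t x) = ∫ s in (0 : ℝ)..t, T.rescaledForcing D l x s := by
  have hgc := T.continuous_rescaledOrbit l (x : X)
  have hcoe : Continuous fun s => (T.truncatedLaplace l s x : X) := by
    simp only [truncatedLaplace_coe]
    exact (continuous_iff_continuousAt.2 fun u =>
      (hgc.integral_hasStrictDerivAt 0 u).hasDerivAt.continuousAt).comp
      (continuous_id.max continuous_const)
  have hcont : Continuous fun s => D (T.truncatedLaplace l s x) := by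
    refine continuous_iff_continuousAt.2 fun s => hD.tendsto (hcoe.tendsto s) ?_
    simp only [generator_truncatedLaplace]
    exact (((hgc.comp (continuous_id.max continuous_const)).sub continuous_const).add
      (hcoe.const_smul l)).tendsto s
  have h0 : D (T.truncatedLaplace l 0 x) = 0 := by
    have : T.truncatedLaplace l 0 (x : X) = 0 := Subtype.ext (by
      rw [truncatedLaplace_coe, max_self, intervalIntegral.integral_same]; rfl)
    rw [this, map_zero]
  rw [intervalIntegral.integral_eq_sub_of_hasDeriv_right (f := fun s =>
    D (T.truncatedLaplace l s x)) hcont.continuousOn ?_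
    ((T.continuous_rescaledForcing hD l x).intervalIntegrable _ _), h0, sub_zero]
  intro s hs
  rw [min_eq_left ht, max_eq_right ht] at hs
  have hs0 : 0 ≤ s := hs.1.le
  have e : T.rescaledForcing D l x s = D (((Real.exp (-l * s) : ℝ) : 𝕜) • T.domainOrbit x s) := by
    rw [map_smul, ← RCLike.real_smul_eq_coe_smul (K := 𝕜)]; rfl
  have d1 : HasDerivWithinAt (fun r => (T.truncatedLaplace l r x : X))
      (T.rescaledOrbit l x s) (Ioi s) s := by
    refine ((hgc.integral_hasStrictDerivAt 0 s).hasDerivAt.hasDerivWithinAt).congr_of_eventuallyEq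
      ?_ ?_
    · filter_upwards [self_mem_nhdsWithin] with r hr
      rw [truncatedLaplace_coe, max_eq_left (hs0.trans (le_of_lt hr))]
    · rw [truncatedLaplace_coe, max_eq_left hs0]
  have d2 := (T.generator_spec x).hasDerivWithinAt_rescaledOrbit l hs0
  rw [e]
  refine hD.hasDerivWithinAt ?_ ?_
  · convert d1 using 1
    exact (RCLike.real_smul_eq_coe_smul (K := 𝕜) _ _).symm
  · have d3 := (d2.sub_const (x : X)).add (d1.const_smul l)
    refine (d3.congr_of_eventuallyEq ?_ ?_).congr_deriv ?_
    · filter_upwards [self_mem_nhdsWithin] with r hr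
      rw [generator_truncatedLaplace, max_eq_left (hs0.trans (le_of_lt hr))]; rfl
    · rw [generator_truncatedLaplace, max_eq_left hs0]; rfl
    · have e2 : T.generator (T.domainOrbit x s) = T s (T.generator x) := by
        rw [← T.generator_map_apply hs0 x]
        congr 1
        exact Subtype.ext (T.domainOrbit_coe x hs0)
      rw [T.generator.map_smul, e2, ← RCLike.real_smul_eq_coe_smul (K := 𝕜),
        T.rescaledOrbit_of_nonneg l x hs0]
      module

/-- Surjectivity of `λ - (A + D)`. -/
theorem MiyaderaBound.exists_resolvent_eq {T : C0Semigroup 𝕜 X}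
    {D : T.generator.domain →ₗ[𝕜] X} {t₀ q : ℝ} (h : T.MiyaderaBound D t₀ q)
    (hD : IsGraphBounded T.generator D) (hq4 : q ≤ 1 / 4) (ht₀ : 0 < t₀) {l : ℝ}
    (hl : 0 ≤ l) (hhalf : Real.exp (-l * t₀) * ‖T t₀‖ ≤ 1 / 2) (y : X) :
    ∃ x : T.generator.domain, l • (x : X) - (T.generator x + D x) = y := by
  have hT0 : ∀ x, T.rescaledOrbit l x (max t₀ 0) = ((Real.exp (-l * t₀) : ℝ) : 𝕜) • T t₀ x :=
    fun x => by rw [max_eq_left ht₀.le, T.rescaledOrbit_of_nonneg l x ht₀.le,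
      RCLike.real_smul_eq_coe_smul (K := 𝕜)]
  obtain ⟨C, hC⟩ := id hD
  obtain ⟨c, hc⟩ := T.exists_norm_truncatedLaplace_le hl t₀
  -- Write `R` for the truncated transform. Since `(l - A) R z = z - exp (-l t₀) T t₀ z`, the ansatz
  -- `x = R z` turns the equation into `(1 - N) z = y` with `N = exp (-l t₀) T t₀ + D R`. Graph
  -- boundedness of `D` only shows that `D R` is bounded.
  let E : X →ₗ[𝕜] X := D.comp (T.truncatedLaplace l t₀)
  have hE : ∃ K, ∀ x, ‖E x‖ ≤ K * ‖x‖ := by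
    refine ⟨max C 0 * (c + (1 / 2 + 1 + l * c)), fun x => ?_⟩
    have h1 : ‖T.generator (T.truncatedLaplace l t₀ x)‖ ≤ (1 / 2 + 1 + l * c) * ‖x‖ := by
      rw [generator_truncatedLaplace, hT0]
      refine (norm_add_le _ _).trans ?_
      have h2 : ‖((Real.exp (-l * t₀) : ℝ) : 𝕜) • T t₀ x‖ ≤ 1 / 2 * ‖x‖ := by
        rw [norm_smul, RCLike.norm_ofReal, abs_of_pos (Real.exp_pos _)]
        calc _ ≤ Real.exp (-l * t₀) * (‖T t₀‖ * ‖x‖) := by gcongr; exact (T t₀).le_opNorm x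
          _ = (Real.exp (-l * t₀) * ‖T t₀‖) * ‖x‖ := by ring
          _ ≤ _ := by gcongr
      have h3 := norm_sub_le (((Real.exp (-l * t₀) : ℝ) : 𝕜) • T t₀ x) x
      have h4 : ‖l • (T.truncatedLaplace l t₀ x : X)‖ ≤ l * (c * ‖x‖) := by
        rw [norm_smul, Real.norm_of_nonneg hl]; gcongr; exact hc x
      linarith
    calc ‖E x‖ ≤ C * (‖(T.truncatedLaplace l t₀ x : X)‖
          + ‖T.generator (T.truncatedLaplace l t₀ x)‖) := hC _
      _ ≤ max C 0 * (c * ‖x‖ + (1 / 2 + 1 + l * c) * ‖x‖) := by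
          gcongr
          · exact le_max_left _ _
          · exact hc x
      _ = _ := by ring
  obtain ⟨K, hK⟩ := hE
  let E' : X →L[𝕜] X := E.mkContinuous K hK
  -- The quantitative bound needs only the dense domain, where the integral formula and the Miyadera
  -- condition apply.
  have hE' : ‖E'‖ ≤ 1 / 4 := by
    refine E'.opNorm_le_of_dense T.dense_domain (by norm_num) fun x hx => ?_
    change ‖D (T.truncatedLaplace l t₀ x)‖ ≤ _
    rw [T.perturbation_truncatedLaplace hD l ⟨x, hx⟩ ht₀.le]
    refine (intervalIntegral.norm_integral_le_integral_norm ht₀.le).trans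
      ((h.integral_norm_rescaledForcing_le_of_le hD hl ⟨x, hx⟩ ht₀.le le_rfl).trans ?_)
    gcongr
  let N : X →L[𝕜] X := ((Real.exp (-l * t₀) : ℝ) : 𝕜) • T t₀ + E'
  -- The two summands have norm at most `1/2` and `1/4`, so a Neumann series inverts `1 - N`.
  have hN : ‖N‖ < 1 := by
    refine (norm_add_le _ _).trans_lt ?_
    rw [norm_smul, RCLike.norm_ofReal, abs_of_pos (Real.exp_pos _)]
    linarith
  let W := Units.oneSub N hN
  have hW : (1 - N) ((↑W⁻¹ : X →L[𝕜] X) y) = y := by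
    have := congrArg (fun L : X →L[𝕜] X => L y) W.mul_inv
    simpa [W, Units.val_oneSub] using this
  set z := (↑W⁻¹ : X →L[𝕜] X) y
  refine ⟨T.truncatedLaplace l t₀ z, ?_⟩
  rw [← hW, generator_truncatedLaplace, hT0]
  change _ = z - (((Real.exp (-l * t₀) : ℝ) : 𝕜) • T t₀ z + D (T.truncatedLaplace l t₀ z))
  abel

end truncatedLaplace

end C0Semigroup

/-! ### The Volterra equation and the perturbed semigroup -/

namespace C0Semigroup

variable {𝕜 : Type*} {X : Type*} [RCLike 𝕜] [NormedAddCommGroup X] [NormedSpace 𝕜 X]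
  [NormedSpace ℝ X] [IsScalarTower ℝ 𝕜 X]
  (T : C0Semigroup 𝕜 X) {D : T.generator.domain →ₗ[𝕜] X}

/-- The right-hand side `∫₀ᵗ Φ(t - s) e^{-λ s} D T s x ds` of the Volterra equation for the
rescaled perturbed semigroup. -/
noncomputable def volterraTerm (D : T.generator.domain →ₗ[𝕜] X) (l : ℝ)
    (Φ : X →L[𝕜] (ℝ →ᵇ X)) (x : T.generator.domain) (t : ℝ) : X :=
  ∫ s in (0 : ℝ)..t, Φ (T.rescaledForcing D l x s) (t - s)

theorem continuous_volterraTerm_integrand (hD : IsGraphBounded T.generator D) (l : ℝ)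
    (Φ : X →L[𝕜] (ℝ →ᵇ X)) (x : T.generator.domain) :
    Continuous (Function.uncurry fun t s : ℝ => Φ (T.rescaledForcing D l x s) (t - s)) := by
  have hf := T.continuous_rescaledForcing hD l x
  simp only [Function.uncurry_def]
  exact (Φ.continuous.comp (hf.comp continuous_snd)).eval (continuous_fst.sub continuous_snd)

theorem continuous_volterraTerm (hD : IsGraphBounded T.generator D) (l : ℝ)
    (Φ : X →L[𝕜] (ℝ →ᵇ X)) (x : T.generator.domain) :
    Continuous (T.volterraTerm D l Φ x) :=
  intervalIntegral.continuous_parametric_intervalIntegral_of_continuous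
    (T.continuous_volterraTerm_integrand hD l Φ x) continuous_id

variable {T}

/-- Weighted integrability of `s ↦ D T s x` on the half line, with constant `1 / 2`. -/
def RescaledMiyaderaBound (T : C0Semigroup 𝕜 X) (D : T.generator.domain →ₗ[𝕜] X) (l : ℝ) : Prop :=
  ∀ (x : T.generator.domain) (t : ℝ), 0 ≤ t →
    (∫ s in (0 : ℝ)..t, ‖T.rescaledForcing D l x s‖) ≤ 1 / 2 * ‖(x : X)‖

/-- Convolution of a bounded operator family with the forcing. -/
theorem norm_integral_le_of_forall_norm_le (hD : IsGraphBounded T.generator D) {l p : ℝ}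
    {x : T.generator.domain} {t : ℝ} (ht : 0 ≤ t)
    (hp : (∫ s in (0 : ℝ)..t, ‖T.rescaledForcing D l x s‖) ≤ p) {g : ℝ → X} {B : ℝ} (hB0 : 0 ≤ B)
    (hg : ∀ s ∈ Ioc 0 t, ‖g s‖ ≤ B * ‖T.rescaledForcing D l x s‖) :
    ‖∫ s in (0 : ℝ)..t, g s‖ ≤ B * p := by
  have hf := (T.continuous_rescaledForcing hD l x).norm
  refine (intervalIntegral.norm_integral_le_of_norm_le ht
    (Eventually.of_forall hg) ((hf.const_mul B).intervalIntegrable 0 t)).trans ?_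
  rw [intervalIntegral.integral_const_mul]
  gcongr

theorem RescaledMiyaderaBound.norm_volterraTerm_le {l : ℝ} (h : T.RescaledMiyaderaBound D l)
    (hD : IsGraphBounded T.generator D) (Φ : X →L[𝕜] (ℝ →ᵇ X)) (x : T.generator.domain)
    {t : ℝ} (ht : 0 ≤ t) : ‖T.volterraTerm D l Φ x t‖ ≤ ‖Φ‖ * (1 / 2 * ‖(x : X)‖) :=
  norm_integral_le_of_forall_norm_le hD ht (h x t ht) (norm_nonneg _) fun _ _ =>
    ((Φ _).norm_coe_le_norm _).trans (Φ.le_opNorm _)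

variable [CompleteSpace X]

/-- The right-hand side makes sense only for `x` in the domain, but it is bounded there by a
multiple of `‖x‖` and extends by density. Values in `ℝ →ᵇ X` build in strong continuity and a
uniform bound; evaluation at `max t 0` freezes the function at negative times. -/
theorem RescaledMiyaderaBound.exists_volterra_step {l C : ℝ} (h : T.RescaledMiyaderaBound D l)
    (hD : IsGraphBounded T.generator D)
    (hC : ∀ t, 0 ≤ t → Real.exp (-l * t) * ‖T t‖ ≤ C) (Φ : X →L[𝕜] (ℝ →ᵇ X)) :
    ∃ Ψ : X →L[𝕜] (ℝ →ᵇ X), ∀ (x : T.generator.domain) (t : ℝ),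
      Ψ x t = T.rescaledOrbit l x (max t 0) + T.volterraTerm D l Φ x (max t 0) := by
  have : SMulCommClass ℝ 𝕜 X := IsScalarTower.to_smulCommClass
  have hm : Continuous fun t : ℝ => max t 0 := continuous_id.max continuous_const
  have hcont : ∀ x : T.generator.domain, Continuous fun t : ℝ =>
      T.rescaledOrbit l x (max t 0) + T.volterraTerm D l Φ x (max t 0) := fun x =>
    ((T.continuous_rescaledOrbit l x).comp hm).add ((T.continuous_volterraTerm hD l Φ x).comp hm)
  have hbound : ∀ (x : T.generator.domain) (t : ℝ),
      ‖T.rescaledOrbit l x (max t 0) + T.volterraTerm D l Φ x (max t 0)‖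
        ≤ (C + ‖Φ‖ * (1 / 2)) * ‖(x : X)‖ := by
    intro x t
    have ht : 0 ≤ max t 0 := le_max_right t 0
    have h1 : ‖T.rescaledOrbit l x (max t 0)‖ ≤ C * ‖(x : X)‖ := by
      rw [T.rescaledOrbit_of_nonneg l x ht, norm_smul, Real.norm_of_nonneg (Real.exp_pos _).le]
      calc _ ≤ Real.exp (-l * max t 0) * (‖T (max t 0)‖ * ‖(x : X)‖) := by
            gcongr; exact ContinuousLinearMap.le_opNorm _ _
        _ = (Real.exp (-l * max t 0) * ‖T (max t 0)‖) * ‖(x : X)‖ := by ring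
        _ ≤ _ := by gcongr; exact hC _ ht
    have h2 := h.norm_volterraTerm_le hD Φ x ht
    refine (norm_add_le _ _).trans ?_
    linarith
  have hint : ∀ (x : T.generator.domain) (t : ℝ), IntervalIntegrable
      (fun s => Φ (T.rescaledForcing D l x s) (t - s)) MeasureTheory.volume 0 t := fun x t =>
    ((T.continuous_volterraTerm_integrand hD l Φ x).comp
      (Continuous.prodMk_right t)).intervalIntegrable _ _
  let L : T.generator.domain →ₗ[𝕜] (ℝ →ᵇ X) :=
    { toFun := fun x => BoundedContinuousFunction.ofNormedAddCommGroup _ (hcont x) _ (hbound x)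
      map_add' := fun x y => by
        ext t
        change T.rescaledOrbit l (x + y : X) (max t 0) + T.volterraTerm D l Φ (x + y) (max t 0)
          = (T.rescaledOrbit l x (max t 0) + T.volterraTerm D l Φ x (max t 0))
            + (T.rescaledOrbit l y (max t 0) + T.volterraTerm D l Φ y (max t 0))
        have e : T.volterraTerm D l Φ (x + y) (max t 0)
            = T.volterraTerm D l Φ x (max t 0) + T.volterraTerm D l Φ y (max t 0) := by
          simp only [volterraTerm]
          rw [← intervalIntegral.integral_add (hint _ _) (hint _ _)]
          simp only [rescaledForcing_add, map_add, BoundedContinuousFunction.add_apply]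
        rw [e, rescaledOrbit, map_add, smul_add, rescaledOrbit, rescaledOrbit]
        abel
      map_smul' := fun c x => by
        ext t
        change T.rescaledOrbit l (c • (x : X)) (max t 0) + T.volterraTerm D l Φ (c • x) (max t 0)
          = c • (T.rescaledOrbit l x (max t 0) + T.volterraTerm D l Φ x (max t 0))
        have e : T.volterraTerm D l Φ (c • x) (max t 0)
            = c • T.volterraTerm D l Φ x (max t 0) := by
          simp only [volterraTerm]
          rw [← intervalIntegral.integral_smul]
          simp only [rescaledForcing_smul, map_smul, BoundedContinuousFunction.smul_apply]
        rw [e, smul_add, rescaledOrbit, map_smul, rescaledOrbit, smul_comm] }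
  have hdense : DenseRange T.generator.domain.subtype := by
    rw [DenseRange, Submodule.coe_subtype, Subtype.range_coe]
    exact T.dense_domain
  have hL : ∃ K, ∀ x, ‖L x‖ ≤ K * ‖T.generator.domain.subtype x‖ := by
    have hC0 : 0 ≤ C := (by positivity : (0 : ℝ) ≤ Real.exp (-l * 0) * ‖T 0‖).trans (hC 0 le_rfl)
    exact ⟨C + ‖Φ‖ * (1 / 2), fun x => (BoundedContinuousFunction.norm_le (by positivity)).2
      (hbound x)⟩
  refine ⟨L.extendOfNorm T.generator.domain.subtype, fun x t => ?_⟩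
  have := LinearMap.extendOfNorm_eq hdense hL x
  rw [Submodule.subtype_apply] at this
  rw [this]
  rfl

/-- In a difference of two steps the orbit term cancels, and the convolution term contributes at
most the factor `1/2`, so Banach's fixed point theorem applies. -/
theorem RescaledMiyaderaBound.exists_volterra_solution {l C : ℝ}
    (h : T.RescaledMiyaderaBound D l) (hD : IsGraphBounded T.generator D)
    (hC : ∀ t, 0 ≤ t → Real.exp (-l * t) * ‖T t‖ ≤ C) :
    ∃ Φ : X →L[𝕜] (ℝ →ᵇ X), ∀ (x : T.generator.domain) (t : ℝ), 0 ≤ t →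
      Φ x t = T.rescaledOrbit l x t + T.volterraTerm D l Φ x t := by
  choose V hV using h.exists_volterra_step hD hC
  have hint : ∀ (Φ : X →L[𝕜] (ℝ →ᵇ X)) (x : T.generator.domain) (t : ℝ), IntervalIntegrable
      (fun s => Φ (T.rescaledForcing D l x s) (t - s)) MeasureTheory.volume 0 t := fun Φ x t =>
    ((T.continuous_volterraTerm_integrand hD l Φ x).comp
      (Continuous.prodMk_right t)).intervalIntegrable _ _
  have hcontr : ContractingWith (1 / 2) V := by
    refine ⟨by rw [← NNReal.coe_lt_coe]; norm_num, LipschitzWith.of_dist_le_mul fun Φ Ψ => ?_⟩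
    rw [dist_eq_norm, dist_eq_norm]
    refine ContinuousLinearMap.opNorm_le_of_dense _ T.dense_domain (by positivity) fun x hx => ?_
    refine (BoundedContinuousFunction.norm_le (by positivity)).2 fun t => ?_
    have e : (V Φ - V Ψ) x t = T.volterraTerm D l (Φ - Ψ) ⟨x, hx⟩ (max t 0) := by
      have h1 := hV Φ ⟨x, hx⟩ t
      have h2 := hV Ψ ⟨x, hx⟩ t
      simp only at h1 h2
      rw [sub_apply, BoundedContinuousFunction.sub_apply, h1, h2,
        add_sub_add_left_eq_sub]
      simp only [volterraTerm]
      rw [← intervalIntegral.integral_sub (hint _ _ _) (hint _ _ _)]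
      rfl
    rw [e]
    refine (h.norm_volterraTerm_le hD _ _ (le_max_right t 0)).trans_eq ?_
    push_cast
    ring
  refine ⟨hcontr.fixedPoint, fun x t ht => ?_⟩
  have h1 := hV hcontr.fixedPoint x t
  rwa [hcontr.fixedPoint_isFixedPt.eq, max_eq_left ht] at h1

theorem volterra_solution_zero {l : ℝ} {Φ : X →L[𝕜] (ℝ →ᵇ X)}
    (hΦ : ∀ (x : T.generator.domain) (t : ℝ), 0 ≤ t →
      Φ x t = T.rescaledOrbit l x t + T.volterraTerm D l Φ x t) (x : X) : Φ x 0 = x := by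
  refine T.dense_domain.induction (P := fun x => Φ x 0 = x) (fun x hx => ?_)
    (isClosed_eq (Φ.continuous.eval continuous_const) continuous_id) x
  rw [hΦ ⟨x, hx⟩ 0 le_rfl, T.rescaledOrbit_of_nonneg l x le_rfl, T.zero_apply]
  simp [volterraTerm]

/-- For fixed `t`, the defect `G s = Φ (t + s) - Φ t ∘ Φ s` solves the homogeneous Volterra
equation, whose only bounded solution is `0`. -/
theorem RescaledMiyaderaBound.volterra_solution_add {l : ℝ} (h : T.RescaledMiyaderaBound D l)
    (hD : IsGraphBounded T.generator D) {Φ : X →L[𝕜] (ℝ →ᵇ X)}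
    (hΦ : ∀ (x : T.generator.domain) (t : ℝ), 0 ≤ t →
      Φ x t = T.rescaledOrbit l x t + T.volterraTerm D l Φ x t) {t s : ℝ} (ht : 0 ≤ t)
    (hs : 0 ≤ s) (x : X) : Φ x (t + s) = Φ (Φ x s) t := by
  let ev : ℝ → X →L[𝕜] X := fun t => (BoundedContinuousFunction.evalCLM 𝕜 t).comp Φ
  have hev : ∀ t x, ev t x = Φ x t := fun t x => rfl
  have hevn : ∀ t, ‖ev t‖ ≤ ‖Φ‖ := fun t => (ev t).opNorm_le_bound (norm_nonneg _) fun x =>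
    ((Φ x).norm_coe_le_norm t).trans (Φ.le_opNorm x)
  let G : ℝ → X →L[𝕜] X := fun s => ev (t + s) - (ev t).comp (ev s)
  have key : ∀ s, 0 ≤ s → ∀ x : T.generator.domain,
      G s x = ∫ r in (0 : ℝ)..s, G (s - r) (T.rescaledForcing D l x r) := by
    intro s hs x
    set f := T.rescaledForcing D l x with hf
    have hfc : Continuous f := T.continuous_rescaledForcing hD l x
    have hc1 : Continuous fun r => Φ (f r) (t + s - r) :=
      (Φ.continuous.comp hfc).eval (by fun_prop)
    have hc2 : Continuous fun r => Φ (f r) (s - r) :=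
      (Φ.continuous.comp hfc).eval (by fun_prop)
    have hc3 : Continuous fun r => Φ (Φ (f r) (s - r)) t :=
      (Φ.continuous.comp hc2).eval continuous_const
    -- The integral is split at `s`; shifted back by `s`, its tail combines with the orbit term into
    -- the Volterra equation for `T s x`.
    have e1 : Φ x (t + s) = Real.exp (-l * s) • Φ (T s x) t
        + ∫ r in (0 : ℝ)..s, Φ (f r) (t + s - r) := by
      rw [hΦ x (t + s) (by positivity), volterraTerm,
        ← intervalIntegral.integral_add_adjacent_intervals (hc1.intervalIntegrable 0 s)
          (hc1.intervalIntegrable s (t + s))]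
      have a1 : (∫ r in s..(t + s), Φ (f r) (t + s - r))
          = Real.exp (-l * s) • T.volterraTerm D l Φ (T.domainOrbit x s) t := by
        have b1 : (∫ r in s..(t + s), Φ (f r) (t + s - r))
            = ∫ r in (0 : ℝ)..t, Φ (f (r + s)) (t + s - (r + s)) := by
          rw [intervalIntegral.integral_comp_add_right (fun r => Φ (f r) (t + s - r)), zero_add]
        rw [b1, volterraTerm, ← intervalIntegral.integral_smul]
        refine intervalIntegral.integral_congr fun r hr => ?_
        rw [uIcc_of_le ht] at hr
        rw [hf, T.rescaledForcing_add_time D l x hr.1 hs, add_sub_add_right_eq_sub, ← hev, ← hev,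
          map_real_smul _ (ev _).continuous]
      have a2 : T.rescaledOrbit l x (t + s) = Real.exp (-l * s) • T.rescaledOrbit l (T s x) t := by
        rw [T.rescaledOrbit_of_nonneg l _ (by positivity), T.rescaledOrbit_of_nonneg l _ ht,
          T.add_apply ht hs, smul_smul, ← Real.exp_add]
        ring_nf
      have a3 := hΦ (T.domainOrbit x s) t ht
      rw [T.domainOrbit_coe x hs] at a3
      rw [a1, a2, a3, smul_add]
      abel
    have e2 : Φ (Φ x s) t = Real.exp (-l * s) • Φ (T s x) t
        + ∫ r in (0 : ℝ)..s, Φ (Φ (f r) (s - r)) t := by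
      rw [hΦ x s hs, map_add, BoundedContinuousFunction.add_apply,
        T.rescaledOrbit_of_nonneg l _ hs, ← hev, map_real_smul _ (ev t).continuous, hev]
      congr 1
      exact ((ev t).intervalIntegral_comp_comm (hc2.intervalIntegrable 0 s)).symm
    change Φ x (t + s) - Φ (Φ x s) t = _
    rw [e1, e2, add_sub_add_left_eq_sub,
      ← intervalIntegral.integral_sub (hc1.intervalIntegrable _ _) (hc3.intervalIntegrable _ _)]
    refine intervalIntegral.integral_congr fun r _ => ?_
    change _ = Φ (f r) (t + (s - r)) - Φ (Φ (f r) (s - r)) t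
    rw [add_sub_assoc]
  -- The bootstrap with `c = 0`: each bound on `G` can be halved.
  have hG : ∀ s : Ici (0 : ℝ), ‖G s‖ ≤ 2 * 0 := by
    refine le_two_mul_of_forall_bound_improves ⟨‖Φ‖ + ‖Φ‖ * ‖Φ‖, fun s => ?_⟩ fun B hB s => ?_
    · refine (norm_sub_le _ _).trans (add_le_add (hevn _) ?_)
      refine (ContinuousLinearMap.opNorm_comp_le _ _).trans ?_
      exact mul_le_mul (hevn _) (hevn _) (norm_nonneg _) (norm_nonneg _)
    · have hB0 : 0 ≤ B := (norm_nonneg _).trans (hB s)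
      refine ContinuousLinearMap.opNorm_le_of_dense _ T.dense_domain (by positivity) fun x hx => ?_
      rw [key s s.2 ⟨x, hx⟩]
      refine (norm_integral_le_of_forall_norm_le hD s.2 (h ⟨x, hx⟩ s s.2) hB0
        fun r hr => ?_).trans_eq (by simp only; ring)
      exact (G (s - r)).le_of_opNorm_le (hB ⟨s - r, sub_nonneg.2 hr.2⟩) _
  have h0 : G s = 0 := norm_le_zero_iff.1 ((hG ⟨s, hs⟩).trans_eq (mul_zero 2))
  have h1 : Φ x (t + s) - Φ (Φ x s) t = 0 := congrArg (fun L : X →L[𝕜] X => L x) h0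
  exact sub_eq_zero.1 h1

/-- The semigroup obtained from a solution of the Volterra equation. -/
theorem RescaledMiyaderaBound.exists_semigroup {l C : ℝ} (h : T.RescaledMiyaderaBound D l)
    (hD : IsGraphBounded T.generator D)
    (hC : ∀ t, 0 ≤ t → Real.exp (-l * t) * ‖T t‖ ≤ C) :
    ∃ (S : C0Semigroup 𝕜 X) (Φ : X →L[𝕜] (ℝ →ᵇ X)),
      (∀ t x, S t x = Real.exp (l * t) • Φ x t) ∧ (∀ x, Φ x 0 = x) ∧
      ∀ (x : T.generator.domain) (t : ℝ), 0 ≤ t →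
        Φ x t = T.rescaledOrbit l x t + T.volterraTerm D l Φ x t := by
  obtain ⟨Φ, hΦ⟩ := h.exists_volterra_solution hD hC
  have hS : ∀ t x, (((Real.exp (l * t) : ℝ) : 𝕜) •
      (BoundedContinuousFunction.evalCLM 𝕜 t).comp Φ) x = Real.exp (l * t) • Φ x t := fun t x =>
    (RCLike.real_smul_eq_coe_smul (K := 𝕜) _ _).symm
  refine ⟨⟨fun t => ((Real.exp (l * t) : ℝ) : 𝕜) •
    (BoundedContinuousFunction.evalCLM 𝕜 t).comp Φ, ?_, ?_, ?_⟩, Φ, hS,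
    volterra_solution_zero hΦ, hΦ⟩
  · ext x
    rw [hS, volterra_solution_zero hΦ]
    simp
  · intro s t hs ht
    ext x
    rw [ContinuousLinearMap.comp_apply, hS t x, map_real_smul _ (ContinuousLinearMap.continuous _),
      hS, hS, h.volterra_solution_add hD hΦ hs ht, smul_smul, ← Real.exp_add]
    ring_nf
  · intro x
    simp only [hS]
    exact ((by fun_prop : Continuous fun t : ℝ => Real.exp (l * t)).smul
      (Φ x).continuous).continuousOn

end C0Semigroup

/-! ### The generator of the perturbed semigroup and variation of constants -/

namespace C0Semigroup

variable {𝕜 : Type*} {X : Type*} [RCLike 𝕜] [NormedAddCommGroup X] [NormedSpace 𝕜 X]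
  [NormedSpace ℝ X]

/-- An eigenvector of the generator for a real eigenvalue beyond the growth bound vanishes. -/
theorem HasOrbitDeriv.eq_zero_of_growth [CompleteSpace X] {S : C0Semigroup 𝕜 X} {l K : ℝ}
    (hS : ∀ t, 0 ≤ t → ‖S t‖ ≤ Real.exp (l * t) * K) {z : X}
    (hz : S.HasOrbitDeriv z ((l + 1) • z)) : z = 0 := by
  -- The orbit rescaled by the eigenvalue has zero right derivative, hence is constant.
  have hconst : ∀ t, 0 ≤ t → z = Real.exp (-(l + 1) * t) • S t z := by
    intro t ht
    have h := intervalIntegral.integral_eq_sub_of_hasDeriv_right (a := 0) (b := t)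
      (f := S.rescaledOrbit (l + 1) z) (f' := fun _ => 0)
      (S.continuous_rescaledOrbit _ z).continuousOn (fun s hs => by
        rw [min_eq_left ht, max_eq_right ht] at hs
        refine (hz.hasDerivWithinAt_rescaledOrbit (l + 1) hs.1.le).congr_deriv ?_
        rw [map_real_smul (S s) (S s).continuous]
        module) (by simp)
    rw [intervalIntegral.integral_zero, S.rescaledOrbit_of_nonneg _ _ ht,
      S.rescaledOrbit_of_nonneg _ _ le_rfl, S.zero_apply] at h
    simp only [mul_zero, Real.exp_zero, one_smul] at h
    exact (sub_eq_zero.1 h.symm).symm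
  have hbound : ∀ t, 0 ≤ t → ‖z‖ ≤ Real.exp (-t) * (K * ‖z‖) := by
    intro t ht
    have h1 : ‖z‖ = Real.exp (-(l + 1) * t) * ‖S t z‖ := by
      conv_lhs => rw [hconst t ht]
      rw [norm_smul, Real.norm_of_nonneg (Real.exp_pos _).le]
    have h2 : Real.exp (-t) = Real.exp (-(l + 1) * t) * Real.exp (l * t) := by
      rw [← Real.exp_add]; ring_nf
    rw [h1, h2, mul_assoc]
    gcongr
    rw [← h1, ← mul_assoc]
    exact (S t).le_of_opNorm_le (hS t ht) z
  have hlim : Tendsto (fun t : ℝ => Real.exp (-t) * (K * ‖z‖)) atTop (𝓝 0) := by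
    simpa using Real.tendsto_exp_neg_atTop_nhds_zero.mul_const (K * ‖z‖)
  refine norm_le_zero_iff.1 (ge_of_tendsto hlim ?_)
  filter_upwards [eventually_ge_atTop 0] with t ht using hbound t ht

variable [IsScalarTower ℝ 𝕜 X] [CompleteSpace X]

/-- The difference quotient of `S` is that of `T` plus an average of a jointly continuous integrand,
whose value at the origin is `Φ (D x) 0 = D x`. -/
theorem hasOrbitDeriv_of_volterra {T S : C0Semigroup 𝕜 X} {D : T.generator.domain →ₗ[𝕜] X}
    (hD : IsGraphBounded T.generator D) {l : ℝ} {Φ : X →L[𝕜] (ℝ →ᵇ X)}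
    (hS : ∀ t x, S t x = Real.exp (l * t) • Φ x t) (hΦ0 : ∀ x, Φ x 0 = x)
    (hΦ : ∀ (x : T.generator.domain) (t : ℝ), 0 ≤ t →
      Φ x t = T.rescaledOrbit l x t + T.volterraTerm D l Φ x t) (x : T.generator.domain) :
    S.HasOrbitDeriv x (T.generator x + D x) := by
  have hk : Continuous (Function.uncurry fun h s : ℝ =>
      Real.exp (l * h) • Φ (T.rescaledForcing D l x s) (h - s)) := by
    have := T.continuous_volterraTerm_integrand hD l Φ x
    simp only [Function.uncurry_def] at this ⊢
    exact (by fun_prop : Continuous fun p : ℝ × ℝ => Real.exp (l * p.1)).smul this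
  have h1 := tendsto_average_of_continuous hk
  have e0 : Real.exp (l * 0) • Φ (T.rescaledForcing D l x 0) (0 - 0) = D x := by
    have : T.domainOrbit x 0 = x :=
      Subtype.ext (by rw [T.domainOrbit_coe x le_rfl, T.zero_apply])
    rw [sub_zero, hΦ0, rescaledForcing, this]
    simp
  rw [e0] at h1
  refine (Tendsto.add (T.generator_spec x) h1).congr' ?_
  filter_upwards [self_mem_nhdsWithin] with h hh
  have hh0 : 0 ≤ h := le_of_lt hh
  have e : Real.exp (l * h) • Real.exp (-l * h) • T h x = T h x := by
    rw [smul_smul, ← Real.exp_add]; simp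
  rw [hS, hΦ x h hh0, T.rescaledOrbit_of_nonneg l _ hh0, intervalIntegral.integral_smul,
    smul_add, e, ← smul_add, volterraTerm]
  congr 1
  abel

/-- The Miyadera perturbation theorem. -/
theorem MiyaderaBound.exists_generator_eq {T : C0Semigroup 𝕜 X}
    {D : T.generator.domain →ₗ[𝕜] X} {t₀ q : ℝ} (h : T.MiyaderaBound D t₀ q)
    (hD : IsGraphBounded T.generator D) (hq : 0 ≤ q) (hq4 : q ≤ 1 / 4) (ht₀ : 0 < t₀) :
    ∃ S : C0Semigroup 𝕜 X, S.generator = perturbedOperator T.generator D := by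
  obtain ⟨l, hl, C, -, hhalf, hC⟩ := T.exists_growth_bound ht₀
  have hR : T.RescaledMiyaderaBound D l := fun x t ht =>
    (h.integral_norm_rescaledForcing_le hD hq ht₀ hl hhalf x ht).trans
      (by gcongr; linarith)
  obtain ⟨S, Φ, hS, hΦ0, hΦ⟩ := hR.exists_semigroup hD hC
  have hsub := fun x => hasOrbitDeriv_of_volterra hD hS hΦ0 hΦ x
  have hgrowth : ∀ t, 0 ≤ t → ‖S t‖ ≤ Real.exp (l * t) * ‖Φ‖ := fun t _ =>
    (S t).opNorm_le_bound (by positivity) fun x => by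
      rw [hS, norm_smul, Real.norm_of_nonneg (Real.exp_pos _).le, mul_assoc]
      gcongr
      exact ((Φ x).norm_coe_le_norm t).trans (Φ.le_opNorm x)
  have hhalf' : Real.exp (-(l + 1) * t₀) * ‖T t₀‖ ≤ 1 / 2 := by
    refine le_trans ?_ hhalf
    gcongr
    linarith
  have hdom : S.generator.domain = T.generator.domain := by
    refine le_antisymm (fun x hx => ?_) fun x hx => (hsub ⟨x, hx⟩).mem_domain
    obtain ⟨y, hy⟩ := hx
    -- If `y` is the orbit derivative of `x` under `S`, solving for `z` makes `x - z` an eigenvector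
    -- of the generator of `S` for the eigenvalue `l + 1`; hence `x = z` lies in the domain of `A`.
    obtain ⟨z, hz⟩ := h.exists_resolvent_eq hD hq4 ht₀ (by linarith : 0 ≤ l + 1) hhalf'
      ((l + 1) • x - y)
    have h1 := hy.add ((hsub z).smul (-1 : 𝕜))
    have h2 : x + (-1 : 𝕜) • (z : X) = 0 := by
      refine HasOrbitDeriv.eq_zero_of_growth hgrowth ?_
      have e : y + (-1 : 𝕜) • (T.generator z + D z) = (l + 1) • (x + (-1 : 𝕜) • (z : X)) := by
        rw [neg_one_smul, neg_one_smul, smul_add, smul_neg, ← sub_eq_add_neg, ← sub_eq_add_neg,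
          sub_eq_sub_iff_sub_eq_sub, ← neg_sub _ y, ← hz]
        abel
      rwa [e] at h1
    rw [neg_one_smul, ← sub_eq_add_neg, sub_eq_zero] at h2
    rw [h2]
    exact z.2
  refine ⟨S, LinearPMap.ext hdom fun x hx' hx => ?_⟩
  have h3 : S.generator ⟨x, hx'⟩ = T.generator ⟨x, hx⟩ + D ⟨x, hx⟩ :=
    HasOrbitDeriv.generator_eq (x := ⟨x, hx'⟩) (hsub ⟨x, hx⟩)
  exact h3

/-- The variation of constants formula for a semigroup whose generator extends `A + D`. -/
theorem sub_apply_eq_integral {T S : C0Semigroup 𝕜 X} {D : T.generator.domain →ₗ[𝕜] X}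
    (hD : IsGraphBounded T.generator D)
    (hS : ∀ x : T.generator.domain, S.HasOrbitDeriv x (T.generator x + D x))
    (x : T.generator.domain) {t : ℝ} (ht : 0 ≤ t) :
    S t x - T t x = ∫ s in (0 : ℝ)..t, S (max (t - s) 0) (D (T.domainOrbit x s)) := by
  have hc1 : Continuous fun s : ℝ => S (max (t - s) 0) (T (max s 0) x) :=
    S.continuous_apply (continuous_const.sub continuous_id) (T.continuous_orbit x)
  have hc2 : Continuous fun s : ℝ => S (max (t - s) 0) (-D (T.domainOrbit x s)) :=
    S.continuous_apply (continuous_const.sub continuous_id)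
      (T.continuous_perturbation_domainOrbit hD x).neg
  have key := intervalIntegral.integral_eq_sub_of_hasDeriv_right (a := 0) (b := t)
    hc1.continuousOn (f' := fun s => S (max (t - s) 0) (-D (T.domainOrbit x s))) ?_
    (hc2.intervalIntegrable _ _)
  · simp only [map_neg, intervalIntegral.integral_neg, sub_self, max_self, sub_zero,
      max_eq_left ht, S.zero_apply, T.zero_apply] at key
    rw [← neg_sub (T t x), ← key, neg_neg]
  intro s hs
  rw [min_eq_left ht, max_eq_right ht] at hs
  obtain ⟨hs0, hst⟩ := hs
  rw [hasDerivWithinAt_iff_tendsto_slope' (by simp)]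
  set y := T.domainOrbit x s with hy
  have hyc : (y : X) = T s x := T.domainOrbit_coe x hs0.le
  have hsub : Tendsto (fun r : ℝ => r - s) (𝓝[>] s) (𝓝[>] 0) := by
    refine tendsto_nhdsWithin_iff.2 ⟨?_, ?_⟩
    · have : Tendsto (fun r : ℝ => r - s) (𝓝 s) (𝓝 (s - s)) :=
        (continuous_id.sub continuous_const).tendsto s
      rw [sub_self] at this
      exact this.mono_left nhdsWithin_le_nhds
    · filter_upwards [self_mem_nhdsWithin] with r hr
      exact mem_Ioi.2 (sub_pos.2 (mem_Ioi.1 hr))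
  have hlt : ∀ᶠ r in 𝓝[>] s, r < t :=
    nhdsWithin_le_nhds (eventually_lt_nhds hst)
  -- The difference quotient of `r ↦ S (t - r) (T r x)` at `s` is `S (t - r)` applied to the
  -- difference of the quotients of `T` and `S` at `y = T s x`. That difference tends to `A y - (A +
  -- D) y = -D y`, and joint continuity of `S` gives the limit.
  have hinner := (Tendsto.comp (T.generator_spec y) hsub).sub (Tendsto.comp (hS y) hsub)
  have hr : Tendsto (fun r : ℝ => t - r) (𝓝[>] s) (𝓝 (t - s)) :=
    ((continuous_const.sub continuous_id).tendsto s).mono_left nhdsWithin_le_nhds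
  have hmain := S.tendsto_apply hr (by linarith)
    (hlt.mono fun r hr => by linarith) hinner
  rw [max_eq_left (by linarith : 0 ≤ t - s)]
  have e : T.generator y - (T.generator y + D y) = -D y := by abel
  rw [e] at hmain
  refine hmain.congr' ?_
  filter_upwards [hlt, self_mem_nhdsWithin] with r hr1 hr2
  have hr2 : s < r := hr2
  have e1 : T r x = T (r - s) (y : X) := by
    rw [hyc, ← T.add_apply (by linarith) hs0.le, sub_add_cancel]
  have e2 : S (t - s) (T s x) = S (t - r) (S (r - s) y) := by
    rw [hyc, ← S.add_apply (by linarith) (by linarith), sub_add_sub_cancel]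
  simp only [Function.comp_apply, slope_def_module]
  rw [max_eq_left (by linarith : 0 ≤ t - s), max_eq_left (by linarith : 0 ≤ t - r),
    max_eq_left (by linarith : 0 ≤ r), max_eq_left hs0.le, e2, e1, ← map_sub,
    ← map_real_smul (S (t - r)) (S (t - r)).continuous, ← smul_sub, sub_sub_sub_cancel_right]

theorem exp_mul_norm_sub_le {T S : C0Semigroup 𝕜 X} {D : T.generator.domain →ₗ[𝕜] X}
    (hD : IsGraphBounded T.generator D)
    (hS : ∀ x : T.generator.domain, S.HasOrbitDeriv x (T.generator x + D x))
    {l p B t : ℝ} (hp : 0 ≤ p) (ht : 0 ≤ t)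
    (hf : ∀ x : T.generator.domain,
      (∫ s in (0 : ℝ)..t, ‖T.rescaledForcing D l x s‖) ≤ p * ‖(x : X)‖)
    (hB : ∀ r ∈ Icc 0 t, Real.exp (-l * r) * ‖S r‖ ≤ B) :
    Real.exp (-l * t) * ‖S t - T t‖ ≤ B * p := by
  have hB0 : 0 ≤ B :=
    (by positivity : (0 : ℝ) ≤ Real.exp (-l * t) * ‖S t‖).trans (hB t ⟨ht, le_rfl⟩)
  have h : ‖S t - T t‖ ≤ Real.exp (l * t) * (B * p) := by
    refine ContinuousLinearMap.opNorm_le_of_dense _ T.dense_domain (by positivity) fun x hx => ?_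
    have e1 := sub_apply_eq_integral hD hS ⟨x, hx⟩ ht
    have e2 : Real.exp (-l * t) • (S t x - T t x) = ∫ s in (0 : ℝ)..t,
        Real.exp (-l * t) • S (max (t - s) 0) (D (T.domainOrbit ⟨x, hx⟩ s)) := by
      rw [intervalIntegral.integral_smul, ← e1]
    have e3 : ‖Real.exp (-l * t) • (S t x - T t x)‖ ≤ B * (p * ‖x‖) := by
      rw [e2]
      refine norm_integral_le_of_forall_norm_le hD ht (hf ⟨x, hx⟩) hB0 fun s hs => ?_
      have hts : 0 ≤ t - s := sub_nonneg.2 hs.2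
      rw [max_eq_left hts, rescaledForcing, norm_smul, norm_smul,
        Real.norm_of_nonneg (Real.exp_pos _).le, Real.norm_of_nonneg (Real.exp_pos _).le]
      have e4 : Real.exp (-l * t) = Real.exp (-l * (t - s)) * Real.exp (-l * s) := by
        rw [← Real.exp_add]; ring_nf
      calc _ ≤ Real.exp (-l * t) * (‖S (t - s)‖ * ‖D (T.domainOrbit ⟨x, hx⟩ s)‖) := by
            gcongr; exact ContinuousLinearMap.le_opNorm _ _
        _ = (Real.exp (-l * (t - s)) * ‖S (t - s)‖) *
            (Real.exp (-l * s) * ‖D (T.domainOrbit ⟨x, hx⟩ s)‖) := by rw [e4]; ring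
        _ ≤ _ := by gcongr; exact hB _ ⟨hts, by linarith [hs.1]⟩
    rw [norm_smul, Real.norm_of_nonneg (Real.exp_pos _).le] at e3
    have e5 : Real.exp (l * t) * Real.exp (-l * t) = 1 := by rw [← Real.exp_add]; simp
    calc ‖(S t - T t) x‖ = Real.exp (l * t) * (Real.exp (-l * t) * ‖S t x - T t x‖) := by
          rw [← mul_assoc, e5, one_mul]; rfl
      _ ≤ Real.exp (l * t) * (B * (p * ‖x‖)) := by gcongr
      _ = _ := by ring
  calc _ ≤ Real.exp (-l * t) * (Real.exp (l * t) * (B * p)) := by gcongr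
    _ = B * p := by rw [← mul_assoc, ← Real.exp_add]; simp

/-- The constants `l` and `C` come from `T` and `t₀` alone, so the estimate is uniform in `D`; this
is what lets `q` be chosen before `D`. -/
theorem MiyaderaBound.norm_sub_le {T S : C0Semigroup 𝕜 X} {D : T.generator.domain →ₗ[𝕜] X}
    {t₀ q : ℝ} (h : T.MiyaderaBound D t₀ q) (hD : IsGraphBounded T.generator D) (hq : 0 ≤ q)
    (hq4 : q ≤ 1 / 4) (ht₀ : 0 < t₀)
    (hS : ∀ x : T.generator.domain, S.HasOrbitDeriv x (T.generator x + D x)) {l C : ℝ}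
    (hl : 0 ≤ l) (hhalf : Real.exp (-l * t₀) * ‖T t₀‖ ≤ 1 / 2)
    (hC : ∀ t, 0 ≤ t → Real.exp (-l * t) * ‖T t‖ ≤ C) {t τ : ℝ} (ht : t ∈ Icc 0 τ) :
    ‖S t - T t‖ ≤ 4 * C * q * Real.exp (l * τ) := by
  have hf : ∀ (t : ℝ), 0 ≤ t → ∀ x : T.generator.domain,
      (∫ s in (0 : ℝ)..t, ‖T.rescaledForcing D l x s‖) ≤ 2 * q * ‖(x : X)‖ := fun t ht x =>
    h.integral_norm_rescaledForcing_le hD hq ht₀ hl hhalf x ht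
  -- Variation of constants improves a bound `B` for the rescaled `S` to `C + 2 * q * B ≤ C + B /
  -- 2`. The local bound of `S` that starts the bootstrap may depend on `D`, but it disappears from
  -- the result.
  have hS2 : ∀ r : Icc (0 : ℝ) τ, Real.exp (-l * r) * ‖S r‖ ≤ 2 * C := by
    refine le_two_mul_of_forall_bound_improves ?_ fun B hB r => ?_
    · obtain ⟨K, hK1, hK⟩ := S.exists_bound_on_Icc τ
      refine ⟨K, fun r => ?_⟩
      have hr := r.2.1
      calc Real.exp (-l * r) * ‖S r‖ ≤ 1 * K := by
            gcongr
            · exact Real.exp_le_one_iff.2 (by nlinarith)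
            · exact hK r r.2
        _ = K := one_mul K
    · have h1 := exp_mul_norm_sub_le hD hS (by positivity : 0 ≤ 2 * q) r.2.1 (hf r r.2.1)
        fun u hu => hB ⟨u, hu.1, hu.2.trans r.2.2⟩
      have hB0 : 0 ≤ B :=
        (by positivity : (0 : ℝ) ≤ Real.exp (-l * r) * ‖S r‖).trans (hB r)
      have h2 : ‖S r‖ ≤ ‖T r‖ + ‖S r - T r‖ := by
        have := norm_add_le (T r) (S r - T r)
        rwa [add_sub_cancel] at this
      calc Real.exp (-l * r) * ‖S r‖ ≤ Real.exp (-l * r) * (‖T r‖ + ‖S r - T r‖) := by gcongr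
        _ = Real.exp (-l * r) * ‖T r‖ + Real.exp (-l * r) * ‖S r - T r‖ := mul_add _ _ _
        _ ≤ C + B * (2 * q) := add_le_add (hC r r.2.1) h1
        _ ≤ C + B / 2 := by nlinarith
  have h1 := exp_mul_norm_sub_le hD hS (by positivity : 0 ≤ 2 * q) ht.1 (hf t ht.1)
    fun u hu => hS2 ⟨u, hu.1, hu.2.trans ht.2⟩
  have e5 : Real.exp (l * t) * Real.exp (-l * t) = 1 := by rw [← Real.exp_add]; simp
  calc ‖S t - T t‖ = Real.exp (l * t) * (Real.exp (-l * t) * ‖S t - T t‖) := by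
        rw [← mul_assoc, e5, one_mul]
    _ ≤ Real.exp (l * τ) * (2 * C * (2 * q)) := by
        gcongr
        exact ht.2
    _ = _ := by ring

end C0Semigroup

/-- The constant `M` is kept and only the rate increases, by at most `M * ‖Q - P‖`. The induction
controls all products `P ^ m * Q ^ k` at once, because replacing one factor `Q` by `P + (Q - P)`
raises `m`. -/
theorem norm_pow_le_of_norm_sub_le {R : Type*} [NormedRing R] {P Q : R} {M r ρ : ℝ}
    (hM : 0 ≤ M) (hr : 0 ≤ r) (hP : ∀ k : ℕ, ‖P ^ k‖ ≤ M * r ^ k)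
    (hPQ : M * ‖Q - P‖ ≤ ρ - r) (k : ℕ) : ‖Q ^ k‖ ≤ M * ρ ^ k := by
  have hρ : 0 ≤ ρ := by
    have := mul_nonneg hM (norm_nonneg (Q - P))
    linarith
  have key : ∀ k m : ℕ, ‖P ^ m * Q ^ k‖ ≤ M * r ^ m * ρ ^ k := by
    intro k
    induction k with
    | zero => intro m; simpa using hP m
    | succ k ih =>
      intro m
      have e : P ^ m * Q ^ (k + 1) = P ^ (m + 1) * Q ^ k + P ^ m * (Q - P) * Q ^ k := by
        rw [pow_succ' Q, pow_succ P]
        noncomm_ring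
      have h0 : ‖Q ^ k‖ ≤ M * ρ ^ k := by simpa using ih 0
      have h1 : ‖P ^ m * (Q - P) * Q ^ k‖ ≤ M * r ^ m * ‖Q - P‖ * (M * ρ ^ k) :=
        (norm_mul_le _ _).trans (mul_le_mul
          ((norm_mul_le _ _).trans (by gcongr; exact hP m)) h0 (norm_nonneg _) (by positivity))
      rw [e]
      calc _ ≤ M * r ^ (m + 1) * ρ ^ k + M * r ^ m * ‖Q - P‖ * (M * ρ ^ k) :=
            (norm_add_le _ _).trans (add_le_add (ih (m + 1)) h1)
        _ = M * r ^ m * ρ ^ k * (r + M * ‖Q - P‖) := by ring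
        _ ≤ M * r ^ m * ρ ^ k * ρ := by gcongr; linarith
        _ = _ := by ring
  simpa using key k 0

/-! ### The evolution operator over one sampling interval -/

namespace C0Semigroup

variable {𝕜 : Type*} {X : Type*} [RCLike 𝕜] [NormedAddCommGroup X] [NormedSpace 𝕜 X]
  [NormedSpace ℝ X] [IsScalarTower ℝ 𝕜 X] [CompleteSpace X]

/-- The evolution operator `z ↦ T t z + ∫₀ᵗ T s K z ds` of the sampled-data system with feedback
operator `K` within one sampling interval. -/
noncomputable def sampledStep (T : C0Semigroup 𝕜 X) (K : X →L[𝕜] X) (t : ℝ) : X →L[𝕜] X :=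
  T t + (LinearMap.mkContinuousOfExistsBound
    (T.generator.domain.subtype.comp (T.truncatedLaplace 0 t))
    (T.exists_norm_truncatedLaplace_le le_rfl t)).comp K

theorem sampledStep_apply (T : C0Semigroup 𝕜 X) (K : X →L[𝕜] X) {t : ℝ} (ht : 0 ≤ t) (z : X) :
    T.sampledStep K t z = T t z + ∫ s in (0 : ℝ)..t, T s (K z) := by
  change T t z + (T.truncatedLaplace 0 t (K z) : X) = _
  rw [truncatedLaplace_coe, max_eq_left ht]
  congr 1
  refine intervalIntegral.integral_congr fun s hs => ?_
  rw [uIcc_of_le ht] at hs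
  rw [T.rescaledOrbit_of_nonneg 0 _ hs.1]
  simp

theorem norm_sampledStep_le (T : C0Semigroup 𝕜 X) (K : X →L[𝕜] X) {t b C : ℝ} (ht : t ∈ Icc 0 b)
    (hC : ∀ s ∈ Icc 0 b, ‖T s‖ ≤ C) : ‖T.sampledStep K t‖ ≤ C * (1 + b * ‖K‖) := by
  have hC0 : 0 ≤ C := (norm_nonneg _).trans (hC t ht)
  have hb : 0 ≤ b := ht.1.trans ht.2
  refine ContinuousLinearMap.opNorm_le_bound _ (by positivity) fun z => ?_
  rw [T.sampledStep_apply K ht.1]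
  have h1 := (T t).le_of_opNorm_le (hC t ht) z
  have h2 : ‖∫ s in (0 : ℝ)..t, T s (K z)‖ ≤ C * (‖K‖ * ‖z‖) * |t - 0| := by
    refine intervalIntegral.norm_integral_le_of_norm_le_const fun s hs => ?_
    rw [uIoc_of_le ht.1] at hs
    refine ((T s).le_of_opNorm_le (hC s ⟨hs.1.le, hs.2.trans ht.2⟩) _).trans ?_
    gcongr
    exact K.le_opNorm z
  rw [sub_zero, abs_of_nonneg ht.1] at h2
  calc _ ≤ C * ‖z‖ + C * (‖K‖ * ‖z‖) * t := (norm_add_le _ _).trans (add_le_add h1 h2)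
    _ ≤ C * ‖z‖ + C * (‖K‖ * ‖z‖) * b := by gcongr; exact ht.2
    _ = _ := by ring

theorem norm_sampledStep_sub_le (T S : C0Semigroup 𝕜 X) (K : X →L[𝕜] X) {b ε : ℝ} (hb : 0 ≤ b)
    (hε : ∀ s ∈ Icc 0 b, ‖S s - T s‖ ≤ ε) :
    ‖S.sampledStep K b - T.sampledStep K b‖ ≤ ε * (1 + b * ‖K‖) := by
  have hε0 : 0 ≤ ε := (norm_nonneg _).trans (hε b ⟨hb, le_rfl⟩)
  refine ContinuousLinearMap.opNorm_le_bound _ (by positivity) fun z => ?_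
  have hi : ∀ R : C0Semigroup 𝕜 X,
      IntervalIntegrable (fun s => R s (K z)) MeasureTheory.volume 0 b := fun R => by
    refine ((R.strongly_continuous' (K z)).mono ?_).intervalIntegrable
    rw [uIcc_of_le hb]
    exact fun s hs => hs.1
  rw [sub_apply, S.sampledStep_apply K hb, T.sampledStep_apply K hb, add_sub_add_comm,
    ← intervalIntegral.integral_sub (hi S) (hi T)]
  have h1 : ‖S b z - T b z‖ ≤ ε * ‖z‖ := (S b - T b).le_of_opNorm_le (hε b ⟨hb, le_rfl⟩) z
  have h2 : ‖∫ s in (0 : ℝ)..b, (S s (K z) - T s (K z))‖ ≤ ε * (‖K‖ * ‖z‖) * |b - 0| := by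
    refine intervalIntegral.norm_integral_le_of_norm_le_const fun s hs => ?_
    rw [uIoc_of_le hb] at hs
    refine ((S s - T s).le_of_opNorm_le (hε s ⟨hs.1.le, hs.2⟩) (K z)).trans ?_
    gcongr
    exact K.le_opNorm z
  rw [sub_zero, abs_of_nonneg hb] at h2
  refine (norm_add_le _ _).trans ((add_le_add h1 h2).trans_eq ?_)
  ring

end C0Semigroup

/-! ### Exponential stability as a bound on powers -/

section SampledData

variable {𝕜 : Type*} {X : Type*} {U : Type*} [RCLike 𝕜]
  [NormedAddCommGroup X] [NormedSpace 𝕜 X] [NormedSpace ℝ X] [IsScalarTower ℝ 𝕜 X]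
  [CompleteSpace X] [NormedAddCommGroup U] [NormedSpace 𝕜 U]
  {T : C0Semigroup 𝕜 X} {B₀ : U →L[𝕜] X} {F : X →L[𝕜] U} {τ : ℝ} {x₀ : X} {x : ℝ → X}

theorem IsSampledDataSolution.apply_add (h : IsSampledDataSolution T B₀ F τ x₀ x) (k : ℕ) {t : ℝ}
    (ht : t ∈ Ioc 0 τ) : x (k * τ + t) = T.sampledStep (B₀.comp F) t (x (k * τ)) := by
  rw [h.step k t ht, T.sampledStep_apply _ ht.1.le]
  rfl

theorem IsSampledDataSolution.apply_mul (h : IsSampledDataSolution T B₀ F τ x₀ x) (hτ : 0 < τ)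
    (k : ℕ) : x (k * τ) = (T.sampledStep (B₀.comp F) τ ^ k) x₀ := by
  induction k with
  | zero => simpa using h.init
  | succ k ih =>
    have e : ((k + 1 : ℕ) : ℝ) * τ = k * τ + τ := by push_cast; ring
    rw [e, h.apply_add k ⟨hτ, le_rfl⟩, ih, pow_succ']
    rfl

/-- Every vector is the initial state of some solution, so the stability estimate at the times `k *
τ` bounds the operator norms of the powers. -/
theorem IsExpStableWithRate.norm_sampledStep_pow_le {ω' M : ℝ} (hτ : 0 < τ) (hM : 0 ≤ M)
    (h : ∀ (x₀ : X) (x : ℝ → X), IsSampledDataSolution T B₀ F τ x₀ x →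
      ∀ t : ℝ, 0 ≤ t → ‖x t‖ ≤ M * Real.exp (-ω' * t) * ‖x₀‖) (k : ℕ) :
    ‖T.sampledStep (B₀.comp F) τ ^ k‖ ≤ M * Real.exp (-ω' * τ) ^ k := by
  refine ContinuousLinearMap.opNorm_le_bound _ (by positivity) fun z => ?_
  obtain ⟨x, hx⟩ := exists_isSampledDataSolution T B₀ F hτ z
  have h1 := h z x hx (k * τ) (by positivity)
  rw [hx.apply_mul hτ] at h1
  rw [← Real.exp_nat_mul]
  convert h1 using 3
  ring_nf

theorem isExpStableWithRate_of_norm_pow_le {ω ω' M : ℝ} (hτ : 0 < τ) (hω : ω < ω')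
    (h : ∀ k : ℕ, ‖T.sampledStep (B₀.comp F) τ ^ k‖ ≤ M * Real.exp (-ω' * τ) ^ k) :
    IsExpStableWithRate T B₀ F τ ω := by
  obtain ⟨C, hC1, hC⟩ := T.exists_bound_on_Icc τ
  set L := C * (1 + τ * ‖B₀.comp F‖) with hL
  have hL1 : 1 ≤ L := by
    have : 0 ≤ τ * ‖B₀.comp F‖ := by positivity
    nlinarith
  have hM : 0 ≤ M := by
    have := (norm_nonneg _).trans (h 0)
    simpa using this
  -- `E` pays for moving the exponent from `k * τ` to `k * τ + t`; the absolute value covers either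
  -- sign of `ω'`.
  set E := Real.exp (|ω'| * τ) with hE
  have hE1 : 1 ≤ E := Real.one_le_exp (by positivity)
  have hexp : ∀ (k : ℕ) (t : ℝ), 0 ≤ t → t ≤ τ →
      Real.exp (-ω' * τ) ^ k ≤ E * Real.exp (-ω' * (k * τ + t)) := by
    intro k t h0 h1
    rw [← Real.exp_nat_mul, hE, ← Real.exp_add, Real.exp_le_exp]
    have h2 : ω' * t ≤ |ω'| * τ :=
      mul_le_mul (le_abs_self _) h1 h0 (abs_nonneg _)
    linarith
  refine ⟨max 1 (L * M * E), le_max_left _ _, ω', hω, fun x₀ x hx t ht => ?_⟩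
  suffices hs : ‖x t‖ ≤ L * M * E * Real.exp (-ω' * t) * ‖x₀‖ by
    refine hs.trans ?_
    gcongr
    exact le_max_right _ _
  set k := ⌊t / τ⌋₊ with hk
  have hk1 : (k : ℝ) * τ ≤ t := by
    rw [← le_div_iff₀ hτ]
    exact Nat.floor_le (by positivity)
  have hk2 : t < ((k : ℝ) + 1) * τ := by
    rw [← div_lt_iff₀ hτ]
    exact Nat.lt_floor_add_one _
  obtain ⟨r, hr⟩ : ∃ r, r = t - k * τ := ⟨_, rfl⟩
  have hr0 : 0 ≤ r := by linarith
  have hrτ : r ≤ τ := by nlinarith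
  have et : t = k * τ + r := by linarith
  have hxk : ‖x (k * τ)‖ ≤ M * Real.exp (-ω' * τ) ^ k * ‖x₀‖ := by
    rw [hx.apply_mul hτ]
    exact ContinuousLinearMap.le_of_opNorm_le _ (h k) _
  have hxt : ‖x t‖ ≤ L * ‖x (k * τ)‖ := by
    -- The recursion covers only `0 < r ≤ τ`; at a sampling time `1 ≤ L` suffices.
    rcases hr0.eq_or_lt with h0 | h0
    · rw [et, ← h0, add_zero]
      exact le_mul_of_one_le_left (norm_nonneg _) hL1
    · rw [et, hx.apply_add k ⟨h0, hrτ⟩]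
      exact ContinuousLinearMap.le_of_opNorm_le _ (T.norm_sampledStep_le _ ⟨hr0, hrτ⟩ hC) _
  calc ‖x t‖ ≤ L * (M * (E * Real.exp (-ω' * (k * τ + r))) * ‖x₀‖) := by
        refine hxt.trans ?_
        gcongr
        refine hxk.trans ?_
        gcongr
        exact hexp k r hr0 hrτ
    _ = _ := by rw [← et]; ring

end SampledData

/-! ### Choice of the threshold and conclusion -/

theorem theorem1 {𝕜 X U : Type*} [RCLike 𝕜]
    [NormedAddCommGroup X] [NormedSpace 𝕜 X] [NormedSpace ℝ X] [IsScalarTower ℝ 𝕜 X]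
    [CompleteSpace X]
    [NormedAddCommGroup U] [NormedSpace 𝕜 U] [CompleteSpace U]
    (T : C0Semigroup 𝕜 X) (B₀ : U →L[𝕜] X) (F : X →L[𝕜] U) (τ : ℝ) (hτ : 0 < τ) (ω : ℝ)
    (hstable : IsExpStableWithRate T B₀ F τ ω) (t₀ : ℝ) (ht₀ : 0 < t₀) :
    ∃ q : ℝ, 0 < q ∧ q < 1 ∧
      ∀ D : T.generator.domain →ₗ[𝕜] X, IsGraphBounded T.generator D →
        (∀ x : T.generator.domain,
          (∫ s in (0 : ℝ)..t₀, ‖D (T.domainOrbit x s)‖) ≤ q * ‖(x : X)‖) →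
        (∃ S : C0Semigroup 𝕜 X, S.generator = perturbedOperator T.generator D) ∧
        ∀ S : C0Semigroup 𝕜 X, S.generator = perturbedOperator T.generator D →
          IsExpStableWithRate S B₀ F τ ω := by
  obtain ⟨M, hM1, ω', hω, hM⟩ := hstable
  obtain ⟨l, hl, C, hC1, hhalf, hC⟩ := T.exists_growth_bound ht₀
  have hM0 : 0 < M := by linarith
  have hC0 : 0 < C := by linarith
  have hpow := IsExpStableWithRate.norm_sampledStep_pow_le hτ hM0.le hM
  set K := B₀.comp F
  set r := Real.exp (-ω' * τ) with hr
  -- The midpoint rate `(ω + ω') / 2` leaves the gap `ρ - r` for the perturbation while still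
  -- exceeding `ω`.
  set ρ := Real.exp (-((ω + ω') / 2) * τ) with hρ
  have hrρ : 0 < ρ - r := by
    rw [sub_pos, hr, hρ, Real.exp_lt_exp]
    nlinarith
  set c := M * (4 * C * Real.exp (l * τ) * (1 + τ * ‖K‖)) with hc
  have hc0 : 0 < c := by positivity
  -- The bound `1/4` serves generation; the bound `(ρ - r) / c` makes `M` times the change of the
  -- step operator at most `ρ - r`.
  have hq0 : 0 < min (1 / 4) ((ρ - r) / c) := lt_min (by norm_num) (div_pos hrρ hc0)
  have hq4 : min (1 / 4) ((ρ - r) / c) ≤ 1 / 4 := min_le_left _ _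
  have hqc : min (1 / 4) ((ρ - r) / c) * c ≤ ρ - r :=
    (le_div_iff₀ hc0).1 (min_le_right _ _)
  generalize min (1 / 4) ((ρ - r) / c) = q at hq0 hq4 hqc
  refine ⟨q, hq0, by linarith, fun D hD hMiy => ?_⟩
  have hMiy' : T.MiyaderaBound D t₀ q := hMiy
  refine ⟨hMiy'.exists_generator_eq hD hq0.le hq4 ht₀, fun S hS => ?_⟩
  -- Stability is derived for any semigroup generated by `A + D` from its orbit derivatives, so
  -- uniqueness of that semigroup is not needed.
  have hSd : ∀ x : T.generator.domain, S.HasOrbitDeriv x (T.generator x + D x) := by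
    intro x
    have hx : (x : X) ∈ S.generator.domain := by rw [hS]; exact x.2
    have h1 := S.generator_spec ⟨x, hx⟩
    have h2 : S.generator ⟨x, hx⟩ = perturbedOperator T.generator D x :=
      (LinearPMap.ext_iff.1 hS).2 (x := x) (hf := hx) (hg := x.2)
    rw [h2] at h1
    exact h1
  have hdiff := T.norm_sampledStep_sub_le S K hτ.le fun s hs =>
    hMiy'.norm_sub_le hD hq0.le hq4 ht₀ hSd hl hhalf hC hs
  refine isExpStableWithRate_of_norm_pow_le hτ (by linarith : ω < (ω + ω') / 2)
    (norm_pow_le_of_norm_sub_le hM0.le (Real.exp_pos _).le hpow ?_)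
  calc M * ‖S.sampledStep K τ - T.sampledStep K τ‖
      ≤ M * (4 * C * q * Real.exp (l * τ) * (1 + τ * ‖K‖)) := by gcongr
    _ = q * c := by rw [hc]; ring
    _ ≤ ρ - r := hqc
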